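/- **Setting.** Let $N\ge 2$, $P,p\in\mathbb N$ and $\epsilon_x>0$. At each time $t=0,1,2,\dots$ and for each pair $1\le m<n\le N$ there are a random weight $w_{mn}(t)=w_{nm}(t)$ and a random dissimilarity $\delta_{mn}(t)=\delta_{nm}(t)$, with $w_{mm}=\delta_{mm}=0$. For $X\in\mathbb R^{N\times P}$ with rows $x_1,\dots,x_N$ let $$[L_t]_{mn}=\begin{cases}-w_{mn}(t)&m\ne n\\ \sum_k w_{mk}(t)&m=n,\end{cases}\qquad [B_t^{\epsilon}(X)]_{mn}=\begin{cases}-\dfrac{w_{mn}(t)\,\delta_{mn}(t)}{\sqrt{\|x_m-x_n\|^2+\epsilon_x}}&m\neq n\\[2mm] \sum_{k\ne m}\dfrac{w_{mk}(t)\,\delta_{mk}(t)}{\sqrt{\|x_m-x_k\|^2+\epsilon_x}}&m=n,\end{cases}$$ let $L_t^\dagger$ be the Moore–Penrose inverse of $L_t$, and let $\mathcal G_t$ be the graph on $\{1,\dots,N\}$ whose edges are the pairs with $w_{mn}(t)\neq 0$. Assume that almost surely every connected component of every $\mathcal G_t$ has exactly $p$ nodes. Let $B^{\mathrm a}(X)=\mathbb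 E[L_t^\dagger B_t^\epsilon(X)]$, which does not depend on $t$ under (A1), and $\upsilon=\frac{N(p-1)}{p(N-1)}$. For $\mu\in(0,1)$ let $\Theta_t\in\mathbb R^{N\times N}$ have $(m,n)$ entry $1-\mu-\frac1N+\frac{\mu}{p}$ if $m=n$, $-\frac1N+\frac{\mu}{p}$ if $m\ne n$ lie in the same component of $\mathcal G_t$, and $-\frac1N$ otherwise. **Algorithms.** From a common (possibly random) starting point $\hat X_0=\tilde X_0\in\mathbb R^{N\times P}$ that is centered at the origin ($\mathbf 1^T\hat X_0=0$) and does not depend on $\mu$, and with step size $\mu$, let $$\hat X_{t+1}=(I-\mu L_t^\dagger L_t)\hat X_t+\mu L_t^\dagger B_t^{\epsilon}(\hat X_t)\hat X_t,\qquad \tilde X_{t+1}=(1-\mu\upsilon)\tilde X_t+\mu B^{\mathrm a}(\tilde X_t)\tilde X_t .$$ **Assumptions.** - (A1) The random arrays $(w_{mn}(t),\delta_{mn}(t))_{m<n}$, $t=0,1,\dots$, are independent and identically distributed over $t$. - (A2) There are constants $C_\delta$ and $\epsilon_w>0$ such that almost surely $\delta_{mn}(t)\in(0,C_\delta]$ and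 $w_{mn}(t)\in\{0\}\cup[\epsilon_w,1]$. - (A3) $\|(I-\mathbf 1\mathbf 1^T/N)\hat X_0\|\le C_x$ for a constant $C_x$. - (A4) Almost surely, for every $\tau\ge0$ there is $t_0$ such that for every $\mu\in(0,1)$ there is $\varrho\in(0,1)$ with $\big\|\prod_{s=\tau+1}^{t}\Theta_s\big\|_2<\varrho^{\,t-\tau}$ for all $t$ with $t-\tau\ge t_0$. - (A5) For each $t$: given the set of pairs with non-zero weight, the non-zero weights $w_{mn}(t)$ are i.i.d. (with a law not depending on that set); and all pairs $m\ne n$ of nodes are equally likely to lie in the same component of $\mathcal G_t$. **Claim.** There are random variables $c(\mu)$, $\mu\in(0,1)$, such that for every $\mu\in(0,1)$ $$\max_{1\le t\le 1/\mu}\|\hat X_t-\tilde X_t\|\le c(\mu),$$ and almost surely $c(\mu)\to0$ as $\mu\to0^+$. Here $\|\cdot\|$ is the Frobenius norm (the Euclidean norm for vectors) and $\|\cdot\|_2$ is the spectral norm. -/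

import Mathlib

open MeasureTheory ProbabilityTheory Filter
open scoped Topology Matrix.Norms.Frobenius

noncomputable section

namespace StochasticSmacof

/-! ### The Moore–Penrose pseudo-inverse of a real square matrix -/

/-- The four Penrose equations: `G` is a Moore–Penrose inverse of `A`. -/
structure IsMoorePenrose {n : Type*} [Fintype n] (A G : Matrix n n ℝ) : Prop where
  left : A * G * A = A
  right : G * A * G = G
  symm_left : (A * G).transpose = A * G
  symm_right : (G * A).transpose = G * A

theorem IsMoorePenrose.unique {n : Type*} [Fintype n] {A G H : Matrix n n ℝ}
    (hG : IsMoorePenrose A G) (hH : IsMoorePenrose A H) : G = H := by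
  have e1 : A * G = A * H := by
    have h : A * G = (A * H * (A * G)).transpose := by
      rw [← Matrix.mul_assoc, hH.left, hG.symm_left]
    rw [Matrix.transpose_mul, hG.symm_left, hH.symm_left, ← Matrix.mul_assoc, hG.left] at h
    exact h
  have e2 : G * A = H * A := by
    have h : G * A = (G * A * (H * A)).transpose := by
      rw [Matrix.mul_assoc, ← Matrix.mul_assoc A, hH.left, hG.symm_right]
    rw [Matrix.transpose_mul, hG.symm_right, hH.symm_right, Matrix.mul_assoc,
      ← Matrix.mul_assoc A, hG.left] at h
    exact h
  calc G = G * A * G := hG.right.symm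
    _ = H * A * G := by rw [e2]
    _ = H * A * H := by rw [Matrix.mul_assoc, e1, ← Matrix.mul_assoc]
    _ = H := hH.right

theorem exists_isMoorePenrose_of_isHermitian {n : Type*} [Fintype n] [DecidableEq n]
    {A : Matrix n n ℝ} (hA : A.IsHermitian) : ∃ G, IsMoorePenrose A G ∧ G.transpose = G := by
  set U : Matrix n n ℝ := (hA.eigenvectorUnitary : Matrix n n ℝ) with hU
  set d : n → ℝ := hA.eigenvalues
  have hUU : star U * U = 1 := Unitary.coe_star_mul_self hA.eigenvectorUnitary
  have hspec : A = U * Matrix.diagonal d * star U := by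
    have h := hA.spectral_theorem
    rw [Unitary.conjStarAlgAut_apply] at h
    exact h
  have hst : star U = U.transpose := by
    rw [Matrix.star_eq_conjTranspose, Matrix.conjTranspose_eq_transpose_of_trivial]
  have key : ∀ a b : n → ℝ, (U * Matrix.diagonal a * star U) * (U * Matrix.diagonal b * star U)
      = U * Matrix.diagonal (fun i => a i * b i) * star U := by
    intro a b
    calc _ = U * Matrix.diagonal a * (star U * U) * Matrix.diagonal b * star U := by
          simp only [Matrix.mul_assoc]
      _ = _ := by
          rw [hUU, Matrix.mul_one, Matrix.mul_assoc U, Matrix.diagonal_mul_diagonal]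
  have tr : ∀ a : n → ℝ, (U * Matrix.diagonal a * star U).transpose
      = U * Matrix.diagonal a * star U := by
    intro a
    simp only [hst, Matrix.transpose_mul, Matrix.transpose_transpose, Matrix.diagonal_transpose,
      Matrix.mul_assoc]
  refine ⟨U * Matrix.diagonal (fun i => (d i)⁻¹) * star U, ⟨?_, ?_, ?_, ?_⟩, tr _⟩
  · rw [hspec, key, key]
    congr 3
    funext i
    exact mul_inv_mul_cancel (d i)
  · rw [hspec, key, key]
    congr 3
    funext i
    by_cases h : d i = 0 <;> simp [h]
  · rw [hspec, key, tr]
  · rw [hspec, key, tr]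

theorem exists_isMoorePenrose {n : Type*} [Fintype n] [DecidableEq n] (A : Matrix n n ℝ) :
    ∃ G, IsMoorePenrose A G := by
  have hS : (A.transpose * A).IsHermitian := by
    rw [Matrix.IsHermitian, Matrix.conjTranspose_eq_transpose_of_trivial, Matrix.transpose_mul,
      Matrix.transpose_transpose]
  obtain ⟨G, hG, hGt⟩ := exists_isMoorePenrose_of_isHermitian hS
  have h1 : A * G * A.transpose * A = A := by
    have h : A.transpose * A * (G * A.transpose * A - 1) = 0 := by
      rw [Matrix.mul_sub, Matrix.mul_one, sub_eq_zero]
      simpa only [Matrix.mul_assoc] using hG.left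
    have h' := (Matrix.conjTranspose_mul_self_mul_eq_zero A (G * A.transpose * A - 1)).1
      (by rw [Matrix.conjTranspose_eq_transpose_of_trivial]; exact h)
    rw [Matrix.mul_sub, Matrix.mul_one, sub_eq_zero] at h'
    simpa only [Matrix.mul_assoc] using h'
  refine ⟨G * A.transpose, ⟨?_, ?_, ?_, ?_⟩⟩
  · simpa only [Matrix.mul_assoc] using h1
  · have h := congrArg (fun M => M * A.transpose) hG.right
    simpa only [Matrix.mul_assoc] using h
  · simp only [Matrix.transpose_mul, Matrix.transpose_transpose, hGt, Matrix.mul_assoc]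
  · have h := hG.symm_right
    simpa only [Matrix.mul_assoc] using h

/-- The Moore–Penrose inverse `A†`. -/
def pinv {n : Type*} [Fintype n] [DecidableEq n] (A : Matrix n n ℝ) : Matrix n n ℝ :=
  Classical.choose (exists_isMoorePenrose A)

theorem isMoorePenrose_pinv {n : Type*} [Fintype n] [DecidableEq n] (A : Matrix n n ℝ) :
    IsMoorePenrose A (pinv A) :=
  Classical.choose_spec (exists_isMoorePenrose A)

/-! ### Weights, dissimilarities and the associated matrices -/

/-- Unordered pairs of distinct nodes, written as pairs `(m, n)` with `m < n`. -/
abbrev Pair (N : ℕ) : Type := {e : Fin N × Fin N // e.1 < e.2}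

/-- The value attached to the unordered pair `{m, n}`; it is `0` for `m = n`. -/
def entry {N : ℕ} (a : Pair N → ℝ) (m n : Fin N) : ℝ :=
  if h : m < n then a ⟨(m, n), h⟩ else if h' : n < m then a ⟨(n, m), h'⟩ else 0

/-- The weighted graph Laplacian `L`. -/
def laplacian {N : ℕ} (w : Pair N → ℝ) : Matrix (Fin N) (Fin N) ℝ :=
  Matrix.of fun m n => if m = n then ∑ k, entry w m k else -entry w m n

/-- Squared Euclidean distance between the rows `m` and `n` of `X`. -/
def sqDist {N P : ℕ} (X : Matrix (Fin N) (Fin P) ℝ) (m n : Fin N) : ℝ :=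
  ∑ k, (X m k - X n k) ^ 2

/-- The matrix `B^ε(X)` for weights `w`, dissimilarities `δ` and regularization `εx`. -/
def bMatrix {N P : ℕ} (εx : ℝ) (w δ : Pair N → ℝ) (X : Matrix (Fin N) (Fin P) ℝ) :
    Matrix (Fin N) (Fin N) ℝ :=
  Matrix.of fun m n =>
    if m = n then ∑ k, entry w m k * entry δ m k / Real.sqrt (sqDist X m k + εx)
    else -(entry w m n * entry δ m n / Real.sqrt (sqDist X m n + εx))

/-- The graph `G` defined by the non-zero weights. -/
def weightGraph {N : ℕ} (w : Pair N → ℝ) : SimpleGraph (Fin N) where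
  Adj m n := m ≠ n ∧ entry w m n ≠ 0
  symm := ⟨by
    rintro m n ⟨hne, h⟩
    refine ⟨hne.symm, ?_⟩
    rcases lt_or_gt_of_ne hne with hl | hl
    · simpa [entry, hl, hl.not_gt] using h
    · simpa [entry, hl, hl.not_gt] using h⟩
  loopless := ⟨fun _ h => h.1 rfl⟩

/-! ### The two algorithms -/

/-- The stochastic SMACOF iterates `X̂_t` for one realization `w`, `δ` of the data. -/
def stochIter {N P : ℕ} (εx μ : ℝ) (w δ : ℕ → Pair N → ℝ) (X₀ : Matrix (Fin N) (Fin P) ℝ) :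
    ℕ → Matrix (Fin N) (Fin P) ℝ
  | 0 => X₀
  | t + 1 =>
    (1 - μ • (pinv (laplacian (w t)) * laplacian (w t))) * stochIter εx μ w δ X₀ t
      + μ • (pinv (laplacian (w t)) * bMatrix εx (w t) (δ t) (stochIter εx μ w δ X₀ t)
          * stochIter εx μ w δ X₀ t)

/-- The averaged matrix `Bᵃ(X) = E[L† B^ε(X)]` for random weights and dissimilarities. -/
def avgB {Ω : Type*} [MeasurableSpace Ω] {N P : ℕ} (Pr : Measure Ω) (εx : ℝ)
    (w δ : Ω → Pair N → ℝ) (X : Matrix (Fin N) (Fin P) ℝ) : Matrix (Fin N) (Fin N) ℝ :=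
  Matrix.of fun m n => ∫ ω, (pinv (laplacian (w ω)) * bMatrix εx (w ω) (δ ω) X) m n ∂Pr

/-- The constant `υ = N (p - 1) / (p (N - 1))`. -/
def upsilon (N p : ℕ) : ℝ := (N : ℝ) * ((p : ℝ) - 1) / ((p : ℝ) * ((N : ℝ) - 1))

/-- The iterates `X̃_{t+1} = (1 - μ υ) X̃_t + μ Bᵃ(X̃_t) X̃_t` driven by a matrix function `Ba`. -/
def avgIter {N P : ℕ} (p : ℕ) (μ : ℝ)
    (Ba : Matrix (Fin N) (Fin P) ℝ → Matrix (Fin N) (Fin N) ℝ) (X₀ : Matrix (Fin N) (Fin P) ℝ) :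
    ℕ → Matrix (Fin N) (Fin P) ℝ
  | 0 => X₀
  | t + 1 =>
    (1 - μ * upsilon N p) • avgIter p μ Ba X₀ t
      + μ • (Ba (avgIter p μ Ba X₀ t) * avgIter p μ Ba X₀ t)

/-! ### The assumptions -/

/-- Every connected component of the weight graph has exactly `p` nodes. -/
def EqualComponents {N : ℕ} (p : ℕ) (w : Pair N → ℝ) : Prop :=
  ∀ C : (weightGraph w).ConnectedComponent, C.supp.ncard = p

/-- The joint data `(w(t), δ(t))`, `t = 0, 1, …`, are random variables that are independent and
identically distributed over time. Nothing is assumed on the dependence within one `t`. -/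
structure IIDData {Ω : Type*} [MeasurableSpace Ω] {N : ℕ} (Pr : Measure Ω)
    (w δ : ℕ → Ω → Pair N → ℝ) : Prop where
  measurable_weight : ∀ t, Measurable (w t)
  measurable_dissim : ∀ t, Measurable (δ t)
  indep : iIndepFun (fun t ω => (w t ω, δ t ω)) Pr
  identDistrib : ∀ t, IdentDistrib (fun ω => (w t ω, δ t ω)) (fun ω => (w 0 ω, δ 0 ω)) Pr Pr

/-- Dissimilarities lie in `(0, Cδ]` and weights in `{0} ∪ [εw, 1]`. -/
structure BoundedData {Ω : Type*} [MeasurableSpace Ω] {N : ℕ} (Pr : Measure Ω) (Cδ εw : ℝ)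
    (w δ : ℕ → Ω → Pair N → ℝ) : Prop where
  dissim_mem : ∀ t e, ∀ᵐ ω ∂Pr, δ t ω e ∈ Set.Ioc 0 Cδ
  weight_mem : ∀ t e, ∀ᵐ ω ∂Pr, w t ω e ∈ {0} ∪ Set.Icc εw 1

/-- The centering matrix `J = I - 𝟏𝟏ᵀ / N`. -/
def centering (N : ℕ) : Matrix (Fin N) (Fin N) ℝ :=
  1 - Matrix.of fun _ _ => 1 / (N : ℝ)

open Classical in
/-- The matrix `Θ` of a graph whose components have size `p`. -/
def theta {N : ℕ} (p : ℕ) (μ : ℝ) (G : SimpleGraph (Fin N)) : Matrix (Fin N) (Fin N) ℝ :=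
  Matrix.of fun m n =>
    if m = n then (1 - μ) - 1 / (N : ℝ) + μ / (p : ℝ)
    else if G.Reachable m n then -1 / (N : ℝ) + μ / (p : ℝ)
    else -1 / (N : ℝ)

/-- The product `Θ_{τ+k} ⋯ Θ_{τ+2} Θ_{τ+1}`. -/
def thetaProd {N : ℕ} (p : ℕ) (μ : ℝ) (w : ℕ → Pair N → ℝ) (τ : ℕ) :
    ℕ → Matrix (Fin N) (Fin N) ℝ
  | 0 => 1
  | k + 1 => theta p μ (weightGraph (w (τ + k + 1))) * thetaProd p μ w τ k

/-- Along almost every realization and from every starting time `τ`, there is `t₀` such that for each `μ ∈ (0, 1)` there is `ϱ ∈ (0, 1)` with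
`‖∏_{s = τ+1}^{t} Θ_s‖₂ < ϱ ^ (t - τ)` whenever `t - τ ≥ t₀` (below, `k = t - τ`). -/
def ContractingProducts {Ω : Type*} [MeasurableSpace Ω] {N : ℕ} (Pr : Measure Ω) (p : ℕ)
    (w : ℕ → Ω → Pair N → ℝ) : Prop :=
  ∀ᵐ ω ∂Pr, ∀ τ : ℕ, ∃ t₀ : ℕ, ∀ μ ∈ Set.Ioo (0 : ℝ) 1, ∃ ϱ ∈ Set.Ioo (0 : ℝ) 1,
    ∀ k : ℕ, t₀ ≤ k →
      ‖Matrix.toEuclideanCLM (𝕜 := ℝ) (thetaProd p μ (fun t => w t ω) τ k)‖ < ϱ ^ k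

/-- Homogeneity of the weights of one time instant. -/
structure HomogeneousWeights {Ω : Type*} [MeasurableSpace Ω] {N : ℕ} (Pr : Measure Ω)
    (w : Ω → Pair N → ℝ) : Prop where
  /-- Given the set `S` of pairs with non-zero weight, the weights on `S` are independent with a
  common law `ν`. -/
  iid_nonzero : ∃ ν : Measure ℝ, IsProbabilityMeasure ν ∧
    ∀ (S : Finset (Pair N)) (A : Pair N → Set ℝ), (∀ e, MeasurableSet (A e)) →
      Pr {ω | (∀ e, w ω e ≠ 0 ↔ e ∈ S) ∧ ∀ e ∈ S, w ω e ∈ A e}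
        = Pr {ω | ∀ e, w ω e ≠ 0 ↔ e ∈ S} * ∏ e ∈ S, ν (A e)
  /-- All pairs of distinct nodes are equally likely to lie in the same component. -/
  equal_pairs : ∀ m n m' n' : Fin N, m ≠ n → m' ≠ n' →
    Pr {ω | (weightGraph (w ω)).Reachable m n} = Pr {ω | (weightGraph (w ω)).Reachable m' n'}

end StochasticSmacof

end

open StochasticSmacof

/-! ### Deterministic averaging -/

section Averaging

/-! Both algorithms are Euler recursions with step `μ`. The stochastic one is driven by i.i.d.
random fields `drift`, and the averaged one by their expectation `meanDrift`. The claim is then a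
pathwise averaging principle over times of order `1 / μ`.

Two facts about the model are needed. First, the fields are almost surely Lipschitz with one
deterministic constant (`exists_drift_lipschitz`). Nonzero weights are at least `εw`, which gives a
Poincaré inequality on each component and hence a bound on `L†` (`abs_pinv_laplacian_le`). The
product `B(X) X` is a sum of smoothed normalizations of row differences. Second, `L† L` is the
identity minus the average over components (`pinv_mul_laplacian`). By the symmetry between pairs,
its expectation is `υ` times the identity on centered matrices, so the mean drift is the stated
averaged field there (`meanDrift_eq`). Centeredness persists because the columns of `L†` sum to
zero.

The averaging itself is deterministic (`eventually_norm_stepIter_sub_le`). The strong law is used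
only at the points of a countable dense set, and equi-Lipschitz continuity upgrades it to a bound `ε
T + C` on partial sums, uniform on balls. The averaged path moves by `O(μ)` per step, so it can be
frozen on a number of blocks that does not depend on `μ`. The accumulated defect times `μ` is then
small, and a discrete Gronwall inequality turns this into a bound on the distance, with factor `exp
Λ`.

The random variable `c(μ)` is the maximal distance itself. Its measurability rests on that of `L†`,
obtained as a limit of Tikhonov regularizations. -/

theorem norm_sum_piecewise_le {E : Type*} [NormedAddCommGroup E] {f : ℕ → E → E} {y : ℕ → E} {b M : ℕ} {σ : ℝ}
    (hσ : ∀ T ≤ M, ∀ s, ‖∑ r ∈ Finset.range T, f r (y s)‖ ≤ σ) {t : ℕ} (ht : t ≤ M) :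
    ‖∑ s ∈ Finset.range t, f s (y (b * (s / b)))‖ ≤ 2 * σ * ((t / b : ℕ) + 1) := by
  have hσ0 : 0 ≤ σ := (norm_nonneg _).trans (hσ 0 (Nat.zero_le _) 0)
  -- Only sums starting at time `0` are controlled, so the whole past is re-evaluated at the current
  -- frozen point. This changes only when `t` enters a new block, at the price of two partial sums,
  -- i.e. `2 * σ`.
  have key : ∀ t ≤ M, ‖∑ s ∈ Finset.range t, f s (y (b * (s / b)))
      - ∑ r ∈ Finset.range t, f r (y (b * (t / b)))‖ ≤ 2 * σ * (t / b : ℕ) := by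
    intro t
    induction t with
    | zero => intro _; simp
    | succ t ih =>
      intro htM
      have e : ∑ s ∈ Finset.range (t + 1), f s (y (b * (s / b)))
          - ∑ r ∈ Finset.range (t + 1), f r (y (b * ((t + 1) / b)))
          = (∑ s ∈ Finset.range t, f s (y (b * (s / b)))
            - ∑ r ∈ Finset.range t, f r (y (b * (t / b))))
            + (∑ r ∈ Finset.range (t + 1), f r (y (b * (t / b)))
              - ∑ r ∈ Finset.range (t + 1), f r (y (b * ((t + 1) / b)))) := by
        rw [Finset.sum_range_succ (fun s => f s (y (b * (s / b)))),
          Finset.sum_range_succ (fun r => f r (y (b * (t / b))))]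
        abel
      rw [e]
      by_cases hd : b ∣ t + 1
      · have h2 : (t + 1) / b = t / b + 1 := by rw [Nat.succ_div, if_pos hd]
        refine (norm_add_le _ _).trans ?_
        have h3 := norm_sub_le (∑ r ∈ Finset.range (t + 1), f r (y (b * (t / b))))
          (∑ r ∈ Finset.range (t + 1), f r (y (b * ((t + 1) / b))))
        have h4 := hσ (t + 1) htM (b * (t / b))
        have h5 := hσ (t + 1) htM (b * ((t + 1) / b))
        have h6 := ih (by omega)
        rw [h2] at h3 h5 ⊢
        push_cast
        linarith
      · have h2 : (t + 1) / b = t / b := by rw [Nat.succ_div, if_neg hd, add_zero]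
        rw [h2, sub_self, add_zero]
        exact ih (by omega)
  have h1 := key t ht
  have h2 := hσ t ht (b * (t / b))
  have h3 := norm_le_norm_sub_add (∑ s ∈ Finset.range t, f s (y (b * (s / b))))
    (∑ r ∈ Finset.range t, f r (y (b * (t / b))))
  linarith

variable {E : Type*} [NormedAddCommGroup E] [NormedSpace ℝ E]

/-- The recursion `x_{t+1} = x_t + μ F_t(x_t)`. -/
def stepIter (μ : ℝ) (F : ℕ → E → E) (x₀ : E) : ℕ → E
  | 0 => x₀
  | t + 1 => stepIter μ F x₀ t + μ • F t (stepIter μ F x₀ t)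

theorem one_add_mul_pow_le_exp {Λ μ : ℝ} (hΛ : 0 ≤ Λ) (hμ : 0 < μ) {t : ℕ} (ht : (t : ℝ) ≤ 1 / μ) :
    (1 + μ * Λ) ^ t ≤ Real.exp Λ := by
  have h1 : 1 + μ * Λ ≤ Real.exp (μ * Λ) := by
    linarith [Real.add_one_le_exp (μ * Λ)]
  have h0 : 0 ≤ 1 + μ * Λ := by positivity
  calc (1 + μ * Λ) ^ t ≤ Real.exp (μ * Λ) ^ t := pow_le_pow_left₀ h0 h1 t
    _ = Real.exp (t * (μ * Λ)) := by rw [Real.exp_nat_mul]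
    _ ≤ Real.exp Λ := by
      apply Real.exp_le_exp.2
      have : (t : ℝ) * μ ≤ 1 := by rwa [le_div_iff₀ hμ] at ht
      nlinarith

/-- Confines the path to a ball whose radius does not depend on `μ`, so that one compactness
argument serves all step sizes. -/
theorem norm_stepIter_le {Λ μ : ℝ} (hΛ : 0 ≤ Λ) (hμ : 0 < μ) {F : ℕ → E → E}
    (hF : ∀ t x, ‖F t x‖ ≤ Λ * ‖x‖) (x₀ : E) {t : ℕ} (ht : (t : ℝ) ≤ 1 / μ) :
    ‖stepIter μ F x₀ t‖ ≤ Real.exp Λ * ‖x₀‖ := by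
  have key : ∀ t, ‖stepIter μ F x₀ t‖ ≤ (1 + μ * Λ) ^ t * ‖x₀‖ := by
    intro t
    induction t with
    | zero => simp [stepIter]
    | succ t ih =>
      have h1 : ‖stepIter μ F x₀ (t + 1)‖ ≤ (1 + μ * Λ) * ‖stepIter μ F x₀ t‖ := by
        calc _ ≤ ‖stepIter μ F x₀ t‖ + ‖μ • F t (stepIter μ F x₀ t)‖ := norm_add_le _ _
          _ ≤ ‖stepIter μ F x₀ t‖ + μ * (Λ * ‖stepIter μ F x₀ t‖) := by
            rw [norm_smul, Real.norm_of_nonneg hμ.le]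
            gcongr
            exact hF _ _
          _ = _ := by ring
      calc _ ≤ _ := h1
        _ ≤ (1 + μ * Λ) * ((1 + μ * Λ) ^ t * ‖x₀‖) := by gcongr
        _ = _ := by ring
  exact (key t).trans (by gcongr; exact one_add_mul_pow_le_exp hΛ hμ ht)

/-- Cesàro convergence to zero at each point of a dense sequence is uniform on balls for
equi-Lipschitz maps. -/
theorem exists_uniform_cesaro_bound [ProperSpace E] {f : ℕ → E → E} {Λ : ℝ} (hΛ : 0 ≤ Λ)
    (hf : ∀ t x y, ‖f t x - f t y‖ ≤ Λ * ‖x - y‖) (hf0 : ∀ t, f t 0 = 0)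
    {d : ℕ → E} (hd : DenseRange d)
    (hlim : ∀ i, Tendsto (fun T : ℕ => (T : ℝ)⁻¹ • ∑ s ∈ Finset.range T, f s (d i)) atTop (𝓝 0))
    (R : ℝ) {ε : ℝ} (hε : 0 < ε) :
    ∃ C : ℝ, 0 ≤ C ∧ ∀ T : ℕ, ∀ x, ‖x‖ ≤ R → ‖∑ s ∈ Finset.range T, f s x‖ ≤ ε * T + C := by
  -- Mesh of a finite net: moving to the nearest net point costs at most `ε / 2` per summand. The `+
  -- 1` covers `Λ = 0`.
  obtain ⟨η, hη, hηε⟩ : ∃ η > 0, Λ * η ≤ ε / 2 :=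
    ⟨ε / 2 / (Λ + 1), by positivity, by
      rw [mul_div_assoc', div_le_iff₀ (by positivity)]; nlinarith⟩
  obtain ⟨S, hS⟩ := (isCompact_closedBall (0 : E) R).elim_finite_subcover
    (fun i => Metric.ball (d i) η) (fun _ => Metric.isOpen_ball) (by
      intro x _
      obtain ⟨i, hi⟩ := hd.exists_dist_lt x hη
      exact Set.mem_iUnion.2 ⟨i, hi⟩)
  have hev : ∀ᶠ T : ℕ in atTop, ∀ i ∈ S,
      ‖(T : ℝ)⁻¹ • ∑ s ∈ Finset.range T, f s (d i)‖ < ε / 2 := by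
    rw [Filter.eventually_all_finset]
    intro i _
    have := (hlim i).norm
    rw [norm_zero] at this
    exact this.eventually_lt_const (half_pos hε)
  obtain ⟨T₀, hT₀⟩ := eventually_atTop.1 hev
  -- The additive constant pays for the times before `T₀`, where only the crude bound `Λ * |R|` per
  -- summand is available.
  refine ⟨T₀ * (Λ * |R|), by positivity, fun T x hx => ?_⟩
  rcases lt_or_ge T T₀ with hT | hT
  · have h1 : ∀ s, ‖f s x‖ ≤ Λ * |R| := by
      intro s
      have := hf s x 0
      rw [hf0, sub_zero, sub_zero] at this
      exact this.trans (by gcongr; exact hx.trans (le_abs_self R))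
    calc _ ≤ ∑ s ∈ Finset.range T, ‖f s x‖ := norm_sum_le _ _
      _ ≤ ∑ s ∈ Finset.range T, Λ * |R| := Finset.sum_le_sum fun s _ => h1 s
      _ = T * (Λ * |R|) := by simp
      _ ≤ T₀ * (Λ * |R|) := by gcongr
      _ ≤ _ := by linarith [mul_nonneg hε.le (Nat.cast_nonneg (α := ℝ) T)]
  · obtain ⟨i, hiS, hi⟩ := Set.mem_iUnion₂.1 (hS (by simpa using hx : x ∈ Metric.closedBall 0 R))
    have h1 : ‖∑ s ∈ Finset.range T, f s (d i)‖ ≤ ε / 2 * T := by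
      rcases Nat.eq_zero_or_pos T with rfl | hpos
      · simp
      have := (hT₀ T hT i hiS).le
      rw [norm_smul, norm_inv, Real.norm_natCast, inv_mul_le_iff₀ (by positivity)] at this
      linarith
    have h2 : ‖∑ s ∈ Finset.range T, f s x - ∑ s ∈ Finset.range T, f s (d i)‖ ≤ ε / 2 * T := by
      rw [← Finset.sum_sub_distrib]
      calc _ ≤ ∑ s ∈ Finset.range T, ‖f s x - f s (d i)‖ := norm_sum_le _ _
        _ ≤ ∑ s ∈ Finset.range T, ε / 2 := Finset.sum_le_sum fun s _ => by
          refine (hf s _ _).trans (le_trans ?_ hηε)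
          gcongr
          rw [← dist_eq_norm]
          exact (Metric.mem_ball.1 hi).le
        _ = _ := by simp [mul_comm]
    have h3 := norm_le_norm_sub_add (∑ s ∈ Finset.range T, f s x)
      (∑ s ∈ Finset.range T, f s (d i))
    have : 0 ≤ T₀ * (Λ * |R|) := by positivity
    linarith

/-- Discrete Gronwall estimate for two recursions in terms of the accumulated defect. -/
theorem norm_stepIter_sub_le {Λ μ D : ℝ} (hΛ : 0 ≤ Λ) (hμ : 0 < μ) {F : ℕ → E → E} {h : E → E}
    (hF : ∀ t x y, ‖F t x - F t y‖ ≤ Λ * ‖x - y‖) (x₀ : E) {M : ℕ} (hM : (M : ℝ) ≤ 1 / μ)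
    (hD : ∀ t ≤ M, ‖∑ s ∈ Finset.range t, (F s (stepIter μ (fun _ => h) x₀ s)
      - h (stepIter μ (fun _ => h) x₀ s))‖ * μ ≤ D) {t : ℕ} (ht : t ≤ M) :
    ‖stepIter μ F x₀ t - stepIter μ (fun _ => h) x₀ t‖ ≤ Real.exp Λ * D := by
  set x := stepIter μ F x₀ with hx
  set y := stepIter μ (fun _ => h) x₀ with hy
  have hD0 : 0 ≤ D := le_trans (by simp) (hD 0 (Nat.zero_le _))
  -- Inserting `F s (y s)` leaves a Lipschitz term for Gronwall and a defect evaluated along the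
  -- averaged path only.
  have e : ∀ t, x t - y t = μ • ∑ s ∈ Finset.range t, (F s (x s) - F s (y s))
      + μ • ∑ s ∈ Finset.range t, (F s (y s) - h (y s)) := by
    intro t
    induction t with
    | zero => simp [hx, hy, stepIter]
    | succ t ih =>
      have e1 : x (t + 1) = x t + μ • F t (x t) := rfl
      have e2 : y (t + 1) = y t + μ • h (y t) := rfl
      rw [Finset.sum_range_succ, Finset.sum_range_succ, smul_add, smul_add, e1, e2,
        add_sub_add_comm, ih]
      simp only [smul_sub]
      abel
  have h1 : ∀ t ≤ M, ‖x t - y t‖ ≤ μ * ∑ s ∈ Finset.range t, Λ * ‖x s - y s‖ + D := by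
    intro t ht
    rw [e t]
    refine (norm_add_le _ _).trans (add_le_add ?_ ?_)
    · rw [norm_smul, Real.norm_of_nonneg hμ.le]
      gcongr
      exact (norm_sum_le _ _).trans (Finset.sum_le_sum fun s _ => hF _ _ _)
    · rw [norm_smul, Real.norm_of_nonneg hμ.le, mul_comm]
      exact hD t ht
  have h2 : ∀ t ≤ M, ∀ s ≤ t, ‖x s - y s‖ ≤ (1 + μ * Λ) ^ s * D := by
    intro t ht s
    induction s using Nat.strong_induction_on with
    | _ s ih =>
      intro hs
      refine (h1 s (hs.trans ht)).trans ?_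
      have h3 : ∑ r ∈ Finset.range s, Λ * ‖x r - y r‖
          ≤ ∑ r ∈ Finset.range s, Λ * ((1 + μ * Λ) ^ r * D) := by
        refine Finset.sum_le_sum fun r hr => ?_
        have hr' := Finset.mem_range.1 hr
        gcongr
        exact ih r hr' (hr'.le.trans hs)
      -- The geometric sum makes the majorant `(1 + μ * Λ) ^ s * D` reproduce itself exactly.
      have h4 := mul_geom_sum (1 + μ * Λ) s
      have h5 : μ * ∑ r ∈ Finset.range s, Λ * ((1 + μ * Λ) ^ r * D)
          = ((1 + μ * Λ) ^ s - 1) * D := by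
        rw [← h4, add_sub_cancel_left, ← Finset.mul_sum, ← Finset.sum_mul]
        ring
      nlinarith
  refine (h2 M le_rfl t ht).trans ?_
  gcongr
  exact one_add_mul_pow_le_exp hΛ hμ (le_trans (by exact_mod_cast ht) hM)

set_option maxHeartbeats 800000 in
/-- The averaging principle: a recursion driven by equi-Lipschitz maps whose Cesàro means converge
follows the averaged recursion over times of order `1 / μ`. -/
theorem eventually_norm_stepIter_sub_le [ProperSpace E] {F : ℕ → E → E} {h : E → E} {Λ : ℝ}
    (hΛ : 0 ≤ Λ) (hF : ∀ t x y, ‖F t x - F t y‖ ≤ Λ * ‖x - y‖) (hF0 : ∀ t, F t 0 = 0)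
    (hh : ∀ x y, ‖h x - h y‖ ≤ Λ * ‖x - y‖) (hh0 : h 0 = 0)
    {d : ℕ → E} (hd : DenseRange d)
    (hlim : ∀ i, Tendsto (fun T : ℕ => (T : ℝ)⁻¹ • ∑ s ∈ Finset.range T, F s (d i)) atTop
      (𝓝 (h (d i)))) (x₀ : E) {ε : ℝ} (hε : 0 < ε) :
    ∀ᶠ μ in 𝓝[>] (0 : ℝ), ∀ t : ℕ, (t : ℝ) ≤ 1 / μ →
      ‖stepIter μ F x₀ t - stepIter μ (fun _ => h) x₀ t‖ ≤ ε := by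
  set R := Real.exp Λ * ‖x₀‖ with hR
  have hR0 : 0 ≤ R := by positivity
  set f : ℕ → E → E := fun t x => F t x - h x with hf
  have hfL : ∀ t x y, ‖f t x - f t y‖ ≤ (2 * Λ) * ‖x - y‖ := by
    intro t x y
    have e : f t x - f t y = (F t x - F t y) - (h x - h y) := by simp only [hf]; abel
    rw [e]
    refine (norm_sub_le _ _).trans ?_
    linarith [hF t x y, hh x y]
  have hf0 : ∀ t, f t 0 = 0 := fun t => by simp [hf, hF0, hh0]
  have hflim : ∀ i, Tendsto (fun T : ℕ => (T : ℝ)⁻¹ • ∑ s ∈ Finset.range T, f s (d i)) atTop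
      (𝓝 0) := by
    intro i
    have h1 := (hlim i).sub_const (h (d i))
    rw [sub_self] at h1
    refine h1.congr' ?_
    filter_upwards [eventually_gt_atTop 0] with T hT
    have hT' : (T : ℝ) ≠ 0 := by positivity
    simp only [hf, Finset.sum_sub_distrib, Finset.sum_const, Finset.card_range, smul_sub]
    rw [← Nat.cast_smul_eq_nsmul ℝ, smul_smul, inv_mul_cancel₀ hT', one_smul]
  obtain ⟨ε₁, hε₁, hε₁ε⟩ : ∃ ε₁ > 0, Real.exp Λ * ε₁ = ε :=
    ⟨ε / Real.exp Λ, by positivity, by field_simp⟩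
  -- Lipschitz constant `2 * Λ` of the centered field times the maximal speed `Λ * R` of the
  -- averaged path. The budget `ε₁` is spent in four quarters: `A / K`, `A * μ`, the Cesàro
  -- tolerance and `q * C * μ`.
  set A := 2 * Λ * (Λ * R) with hA
  have hA0 : 0 ≤ A := by positivity
  -- The number of blocks is fixed before `μ`.
  obtain ⟨K, hK⟩ : ∃ K : ℕ, 4 * A / ε₁ < K := exists_nat_gt _
  have hKpos : (0 : ℝ) < K := lt_of_le_of_lt (by positivity) hK
  -- The factor that `norm_sum_piecewise_le` puts on the partial-sum bound when there are `K` full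
  -- blocks.
  set q : ℝ := 2 * (K + 1) with hq
  have hqpos : 0 < q := by positivity
  obtain ⟨C, hC0, hC⟩ := exists_uniform_cesaro_bound (by positivity) hfL hf0 hd hflim R
    (show 0 < ε₁ / (4 * q) by positivity)
  have ev1 : ∀ᶠ μ in 𝓝[>] (0 : ℝ), A * μ < ε₁ / 4 := by
    have : Tendsto (fun μ : ℝ => A * μ) (𝓝[>] 0) (𝓝 (A * 0)) :=
      (tendsto_const_nhds.mul tendsto_id).mono_left nhdsWithin_le_nhds
    rw [mul_zero] at this
    exact this.eventually_lt_const (by positivity)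
  have ev2 : ∀ᶠ μ in 𝓝[>] (0 : ℝ), q * C * μ < ε₁ / 4 := by
    have : Tendsto (fun μ : ℝ => q * C * μ) (𝓝[>] 0) (𝓝 (q * C * 0)) :=
      (tendsto_const_nhds.mul tendsto_id).mono_left nhdsWithin_le_nhds
    rw [mul_zero] at this
    exact this.eventually_lt_const (by positivity)
  filter_upwards [ev1, ev2, self_mem_nhdsWithin] with μ hμ1 hμ2 hμ t ht
  have hμ : 0 < μ := hμ
  set y := stepIter μ (fun _ => h) x₀ with hy
  have hhn : ∀ x, ‖h x‖ ≤ Λ * ‖x‖ := fun x => by simpa [hh0] using hh x 0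
  set M := ⌊1 / μ⌋₊ with hMdef
  have hM : (M : ℝ) ≤ 1 / μ := Nat.floor_le (by positivity)
  have hMμ : M * μ ≤ 1 := by rwa [le_div_iff₀ hμ] at hM
  have htM : t ≤ M := Nat.le_floor ht
  have hyR : ∀ s ≤ M, ‖y s‖ ≤ R := fun s hs =>
    norm_stepIter_le hΛ hμ (fun _ => hhn) x₀ (le_trans (by exact_mod_cast hs) hM)
  rw [← hε₁ε]
  refine norm_stepIter_sub_le hΛ hμ hF x₀ hM (fun t ht => ?_) htM
  -- blocks of length `b`
  set b := M / K + 1 with hb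
  have hKn : 0 < K := by exact_mod_cast hKpos
  have hbpos : 0 < b := Nat.succ_pos _
  -- The `+ 1` in `b` gives `M < K * b` and costs only an extra `μ` in `b * μ`.
  have htb : t / b ≤ K := by
    rw [Nat.div_le_iff_le_mul_add_pred hbpos]
    have : M < K * b := by
      have := Nat.lt_mul_div_succ M hKn
      simpa [hb] using this
    have e : b * K = K * b := mul_comm _ _
    omega
  have hbμ : b * μ ≤ 1 / K + μ := by
    have h1 : ((M / K : ℕ) : ℝ) ≤ M / K := Nat.cast_div_le
    have h2 : (M : ℝ) / K * μ ≤ 1 / K := by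
      rw [div_mul_eq_mul_div]; gcongr
    have h3 := mul_le_mul_of_nonneg_right h1 hμ.le
    rw [hb]; push_cast
    linarith
  have hslow : ∀ s k, s + k ≤ M → ‖y (s + k) - y s‖ ≤ k * (μ * (Λ * R)) := by
    intro s k
    induction k with
    | zero => simp
    | succ k ih =>
      intro hk
      have e1 : y (s + (k + 1)) = y (s + k) + μ • h (y (s + k)) := rfl
      have e2 : y (s + (k + 1)) - y s = (y (s + k) - y s) + μ • h (y (s + k)) := by
        rw [e1]; abel
      rw [e2]
      refine (norm_add_le _ _).trans ?_
      have h1 := ih (by omega)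
      have h2 : ‖μ • h (y (s + k))‖ ≤ μ * (Λ * R) := by
        rw [norm_smul, Real.norm_of_nonneg hμ.le]
        gcongr
        exact (hhn _).trans (by gcongr; exact hyR _ (by omega))
      push_cast
      linarith
  -- the comparison with the piecewise constant path
  have herr : ‖∑ s ∈ Finset.range t, f s (y s) - ∑ s ∈ Finset.range t, f s (y (b * (s / b)))‖
      ≤ M * (A * (b * μ)) := by
    rw [← Finset.sum_sub_distrib]
    calc _ ≤ ∑ s ∈ Finset.range t, ‖f s (y s) - f s (y (b * (s / b)))‖ := norm_sum_le _ _
      _ ≤ ∑ s ∈ Finset.range t, A * (b * μ) := Finset.sum_le_sum fun s hs => by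
        have hs' := Finset.mem_range.1 hs
        have hdm := Nat.div_add_mod s b
        have hmod := (Nat.mod_lt s hbpos).le
        have h1 := hslow (b * (s / b)) (s % b) (by omega)
        rw [hdm] at h1
        refine (hfL s _ _).trans ?_
        calc _ ≤ 2 * Λ * ((s % b : ℕ) * (μ * (Λ * R))) := by gcongr
          _ ≤ 2 * Λ * (b * (μ * (Λ * R))) := by gcongr
          _ = _ := by rw [hA]; ring
      _ = t * (A * (b * μ)) := by simp
      _ ≤ _ := by gcongr
  -- Freezing the path after `M` gives a bound at every index, as `norm_sum_piecewise_le` requires,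
  -- without changing the sums in question.
  set y' : ℕ → E := fun s => y (min s M) with hy'
  have hmain := norm_sum_piecewise_le (f := f) (y := y') (b := b) (M := M)
    (σ := ε₁ / (4 * q) * M + C) (fun T hT s => (hC T _ (hyR _ (min_le_right _ _))).trans
      (by gcongr)) ht
  have ey : ∑ s ∈ Finset.range t, f s (y' (b * (s / b)))
      = ∑ s ∈ Finset.range t, f s (y (b * (s / b))) := by
    refine Finset.sum_congr rfl fun s hs => ?_
    have hs' := Finset.mem_range.1 hs
    have := Nat.mul_div_le s b
    rw [hy']; simp only; rw [min_eq_left (by omega)]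
  rw [ey] at hmain
  have htbR : ((t / b : ℕ) : ℝ) + 1 ≤ K + 1 := by gcongr
  have hσ0 : 0 ≤ ε₁ / (4 * q) * M + C := by positivity
  have hmain' : ‖∑ s ∈ Finset.range t, f s (y (b * (s / b)))‖ ≤ q * (ε₁ / (4 * q) * M + C) := by
    refine hmain.trans ?_
    rw [hq]
    linarith [mul_le_mul_of_nonneg_left htbR hσ0]
  have htri := norm_le_norm_sub_add (∑ s ∈ Finset.range t, f s (y s))
    (∑ s ∈ Finset.range t, f s (y (b * (s / b))))
  have hAK : A * (1 / K) ≤ ε₁ / 4 := by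
    rw [mul_one_div, div_le_iff₀ hKpos]
    rw [div_lt_iff₀ hε₁] at hK
    linarith
  have b1 : M * (A * (b * μ)) * μ ≤ ε₁ / 2 := by
    have h1 : A * (b * μ) ≤ ε₁ / 2 := by
      have := mul_le_mul_of_nonneg_left hbμ hA0
      linarith
    have h0 : 0 ≤ A * (b * μ) := by positivity
    calc M * (A * (b * μ)) * μ = (M * μ) * (A * (b * μ)) := by ring
      _ ≤ 1 * (A * (b * μ)) := by gcongr
      _ ≤ ε₁ / 2 := by linarith
  have b2 : q * (ε₁ / (4 * q) * M + C) * μ ≤ ε₁ / 2 := by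
    have e : q * (ε₁ / (4 * q) * M + C) * μ = ε₁ / 4 * (M * μ) + q * C * μ := by
      field_simp
    rw [e]
    have := mul_le_mul_of_nonneg_left hMμ (show 0 ≤ ε₁ / 4 by positivity)
    linarith
  calc _ ≤ (M * (A * (b * μ)) + q * (ε₁ / (4 * q) * M + C)) * μ := by
        gcongr
        exact htri.trans (add_le_add herr hmain')
    _ ≤ ε₁ := by rw [add_mul]; linarith

end Averaging

/-! ### Measurability of the Moore–Penrose inverse -/

section Pinv

variable {n : Type*} [Fintype n]

theorem Matrix.abs_apply_le_frobenius {m : Type*} [Fintype m] (A : Matrix m n ℝ) (i : m) (j : n) :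
    |A i j| ≤ ‖A‖ := by
  rw [Matrix.frobenius_norm_def, ← Real.sqrt_eq_rpow]
  apply Real.abs_le_sqrt
  have h1 : A i j ^ 2 ≤ ∑ j, ‖A i j‖ ^ (2 : ℝ) := by
    have := Finset.single_le_sum (f := fun j => ‖A i j‖ ^ (2 : ℝ)) (fun j _ => by positivity)
      (Finset.mem_univ j)
    simpa using this
  exact h1.trans (Finset.single_le_sum (f := fun i => ∑ j, ‖A i j‖ ^ (2 : ℝ))
    (fun i _ => by positivity) (Finset.mem_univ i))

theorem Matrix.frobenius_le_of_abs_apply_le {m : Type*} [Fintype m] {A : Matrix m n ℝ} {c : ℝ}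
    (hc : 0 ≤ c) (h : ∀ i j, |A i j| ≤ c) :
    ‖A‖ ≤ Real.sqrt (Fintype.card m * Fintype.card n) * c := by
  rw [Matrix.frobenius_norm_def, ← Real.sqrt_eq_rpow]
  apply Real.sqrt_le_iff.2 ⟨by positivity, ?_⟩
  rw [mul_pow, Real.sq_sqrt (by positivity)]
  calc ∑ i, ∑ j, ‖A i j‖ ^ (2 : ℝ) ≤ ∑ _i : m, ∑ _j : n, c ^ 2 := by
        refine Finset.sum_le_sum fun i _ => Finset.sum_le_sum fun j _ => ?_
        rw [Real.rpow_two, Real.norm_eq_abs]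
        exact pow_le_pow_left₀ (abs_nonneg _) (h i j) 2
    _ = _ := by simp; ring

theorem measurable_matrix_mul {α m k : Type*} [MeasurableSpace α] {f : α → Matrix m n ℝ}
    {g : α → Matrix n k ℝ} (hf : ∀ i j, Measurable fun a => f a i j)
    (hg : ∀ i j, Measurable fun a => g a i j) (i : m) (j : k) :
    Measurable fun a => (f a * g a) i j := by
  simp only [Matrix.mul_apply]
  exact Finset.measurable_sum _ fun l _ => (hf i l).mul (hg l j)

theorem measurable_frobenius_norm {α m : Type*} [Fintype m] [MeasurableSpace α]
    {f : α → Matrix m n ℝ} (hf : ∀ i j, Measurable fun a => f a i j) :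
    Measurable fun a => ‖f a‖ := by
  simp only [Matrix.frobenius_norm_def]
  exact (Finset.measurable_sum _ fun i _ => Finset.measurable_sum _ fun j _ =>
    (hf i j).norm.pow_const _).pow_const _

variable [DecidableEq n]

theorem measurable_matrix_det {α : Type*} [MeasurableSpace α] {f : α → Matrix n n ℝ}
    (hf : ∀ i j, Measurable fun a => f a i j) : Measurable fun a => (f a).det := by
  simp only [Matrix.det_apply]
  exact Finset.measurable_sum _ fun σ _ =>
    (Finset.measurable_prod _ fun i _ => hf _ _).const_smul (Equiv.Perm.sign σ)

/-- Cramer's rule. Real inversion is measurable also at `0`, so no invertibility is required. -/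
theorem measurable_matrix_inv {α : Type*} [MeasurableSpace α] {f : α → Matrix n n ℝ}
    (hf : ∀ i j, Measurable fun a => f a i j) (i j : n) : Measurable fun a => (f a)⁻¹ i j := by
  simp only [Matrix.inv_def, Matrix.smul_apply, Matrix.adjugate_apply, Ring.inverse_eq_inv',
    smul_eq_mul]
  refine (measurable_matrix_det hf).inv.mul (measurable_matrix_det fun k l => ?_)
  by_cases h : k = j
  · subst h; simp
  · simpa [Matrix.updateRow_ne h] using hf k l

/-- Resolvent estimate for the regularized Gram matrix. -/
theorem sum_sq_le_of_gram_add_mulVec (A : Matrix n n ℝ) {ε : ℝ} (hε : 0 < ε) {v y : n → ℝ}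
    (h : (A.transpose * A + ε • (1 : Matrix n n ℝ)).mulVec v = y) :
    ∑ i, (ε * v i) ^ 2 ≤ ∑ i, y i ^ 2 := by
  have h0 : 0 ≤ v ⬝ᵥ (A.transpose * A).mulVec v := by
    rw [← Matrix.mulVec_mulVec, Matrix.dotProduct_mulVec, Matrix.vecMul_transpose]
    exact Finset.sum_nonneg fun i _ => mul_self_nonneg _
  have h1 : ε * ∑ i, v i ^ 2 ≤ ∑ i, v i * y i := by
    have e : v ⬝ᵥ y = v ⬝ᵥ (A.transpose * A).mulVec v + ε * (v ⬝ᵥ v) := by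
      rw [← h, Matrix.add_mulVec, dotProduct_add, Matrix.smul_mulVec, Matrix.one_mulVec,
        dotProduct_smul, smul_eq_mul]
    simp only [dotProduct] at e h0
    rw [e]
    simp only [sq]
    linarith
  have h2 : ∑ i, (ε * v i) ^ 2 ≤ ∑ i, ε * v i * y i := by
    have e1 : ∑ i, (ε * v i) ^ 2 = ε * (ε * ∑ i, v i ^ 2) := by
      simp only [Finset.mul_sum]; exact Finset.sum_congr rfl fun _ _ => by ring
    have e2 : ∑ i, ε * v i * y i = ε * ∑ i, v i * y i := by
      simp only [Finset.mul_sum]; exact Finset.sum_congr rfl fun _ _ => by ring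
    rw [e1, e2]
    gcongr
  have h3 : 2 * ∑ i, ε * v i * y i ≤ ∑ i, (ε * v i) ^ 2 + ∑ i, y i ^ 2 := by
    rw [Finset.mul_sum, ← Finset.sum_add_distrib]
    exact Finset.sum_le_sum fun i _ => by nlinarith [sq_nonneg (ε * v i - y i)]
  linarith

theorem isUnit_det_gram_add (A : Matrix n n ℝ) {ε : ℝ} (hε : 0 < ε) :
    IsUnit (A.transpose * A + ε • (1 : Matrix n n ℝ)).det := by
  rw [← Matrix.isUnit_iff_isUnit_det, ← Matrix.mulVec_injective_iff_isUnit]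
  rw [← Matrix.coe_mulVecLin]
  rw [injective_iff_map_eq_zero]
  intro v hv
  have h := sum_sq_le_of_gram_add_mulVec A hε (v := v) (y := 0) hv
  have h' : ∑ i, (ε * v i) ^ 2 = 0 :=
    le_antisymm (by simpa using h) (Finset.sum_nonneg fun i _ => sq_nonneg _)
  funext i
  have := (Finset.sum_eq_zero_iff_of_nonneg (fun i _ => sq_nonneg (ε * v i))).1 h' i
    (Finset.mem_univ i)
  have := pow_eq_zero_iff (two_ne_zero) |>.1 this
  rcases mul_eq_zero.1 this with h | h
  · exact absurd h hε.ne'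
  · exact h

/-- By the resolvent estimate, one factor `ε k` already keeps each column bounded. The second one
forces convergence. -/
theorem tendsto_smul_inv_gram_add_mul (A Y : Matrix n n ℝ) {ε : ℕ → ℝ} (hε : ∀ k, 0 < ε k)
    (hlim : Tendsto ε atTop (𝓝 0)) (i j : n) :
    Tendsto (fun k => ε k * (ε k * ((A.transpose * A + ε k • (1 : Matrix n n ℝ))⁻¹ * Y) i j))
      atTop (𝓝 0) := by
  refine squeeze_zero_norm (a := fun k => ε k * Real.sqrt (∑ i, Y i j ^ 2)) (fun k => ?_) ?_
  · rw [norm_mul, Real.norm_of_nonneg (hε k).le]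
    refine mul_le_mul_of_nonneg_left ?_ (hε k).le
    rw [Real.norm_eq_abs]
    apply Real.abs_le_sqrt
    have h := sum_sq_le_of_gram_add_mulVec A (hε k)
      (v := ((A.transpose * A + ε k • (1 : Matrix n n ℝ))⁻¹ * Y).col j) (y := Y.col j) (by
        rw [← Matrix.mulVec_single_one, ← Matrix.mulVec_single_one, Matrix.mulVec_mulVec,
          Matrix.mul_nonsing_inv_cancel_left _ _ (isUnit_det_gram_add A (hε k))])
    exact (Finset.single_le_sum (f := fun i =>
      (ε k * ((A.transpose * A + ε k • (1 : Matrix n n ℝ))⁻¹ * Y) i j) ^ 2)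
      (fun i _ => sq_nonneg _) (Finset.mem_univ i)).trans h
  · simpa using hlim.mul_const (Real.sqrt (∑ i, Y i j ^ 2))

/-- The Moore–Penrose inverse as a Tikhonov limit. -/
theorem tendsto_inv_gram_add_mul_transpose (A : Matrix n n ℝ) {ε : ℕ → ℝ} (hε : ∀ k, 0 < ε k)
    (hlim : Tendsto ε atTop (𝓝 0)) (i j : n) :
    Tendsto (fun k => ((A.transpose * A + ε k • (1 : Matrix n n ℝ))⁻¹ * A.transpose) i j)
      atTop (𝓝 (pinv A i j)) := by
  have hG := isMoorePenrose_pinv A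
  set G := pinv A
  -- `Y` solves `Aᵀ A Y = G`. Hence the resolvent identity can be applied twice, first to `Aᵀ = Aᵀ A
  -- G` and then to `G`, which leaves a remainder of second order in `ε k`.
  set Y := G * (G.transpose * G) with hY
  have e1 : A.transpose * A * G = A.transpose := by
    have h := congrArg Matrix.transpose hG.left
    rwa [Matrix.transpose_mul, hG.symm_left, ← Matrix.mul_assoc] at h
  have e2 : A.transpose * A * Y = G := by
    have h : A.transpose * (G.transpose * G) = G := by
      rw [← Matrix.mul_assoc, ← Matrix.transpose_mul, hG.symm_right, hG.right]
    rw [hY, ← Matrix.mul_assoc, e1, h]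
  have key : ∀ k, ((A.transpose * A + ε k • (1 : Matrix n n ℝ))⁻¹ * A.transpose) i j
      = G i j - (ε k * Y i j
        - ε k * (ε k * ((A.transpose * A + ε k • (1 : Matrix n n ℝ))⁻¹ * Y) i j)) := by
    intro k
    have hu := isUnit_det_gram_add A (hε k)
    set M := A.transpose * A + ε k • (1 : Matrix n n ℝ) with hM
    have f1 : M⁻¹ * A.transpose = G - ε k • (M⁻¹ * G) := by
      have : A.transpose = M * G - ε k • G := by
        rw [hM, Matrix.add_mul, e1, Matrix.smul_mul, Matrix.one_mul, add_sub_cancel_right]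
      conv_lhs => rw [this]
      rw [Matrix.mul_sub, Matrix.nonsing_inv_mul_cancel_left _ _ hu, Matrix.mul_smul]
    have f2 : M⁻¹ * G = Y - ε k • (M⁻¹ * Y) := by
      have : G = M * Y - ε k • Y := by
        rw [hM, Matrix.add_mul, e2, Matrix.smul_mul, Matrix.one_mul, add_sub_cancel_right]
      conv_lhs => rw [this]
      rw [Matrix.mul_sub, Matrix.nonsing_inv_mul_cancel_left _ _ hu, Matrix.mul_smul]
    rw [f1, f2]
    simp only [Matrix.sub_apply, Matrix.smul_apply, smul_eq_mul]
    ring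
  simp only [key]
  have h1 := tendsto_smul_inv_gram_add_mul A Y hε hlim i j
  have h2 := (hlim.mul_const (Y i j)).sub h1
  simpa using h2.const_sub (G i j)

/-- The pseudo-inverse jumps where the rank changes, so continuity is not available. It is instead a
pointwise limit of measurable regularized inverses. -/
theorem measurable_pinv {α : Type*} [MeasurableSpace α] {f : α → Matrix n n ℝ}
    (hf : ∀ i j, Measurable fun a => f a i j) (i j : n) : Measurable fun a => pinv (f a) i j := by
  refine measurable_of_tendsto_metrizable (f := fun (k : ℕ) a =>
    (((f a).transpose * f a + (1 / ((k : ℝ) + 1)) • (1 : Matrix n n ℝ))⁻¹ * (f a).transpose) i j)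
    (fun k => ?_) (tendsto_pi_nhds.2 fun a => tendsto_inv_gram_add_mul_transpose (f a)
      (fun k => by positivity) tendsto_one_div_add_atTop_nhds_zero_nat i j)
  refine measurable_matrix_mul (fun i j => measurable_matrix_inv (fun i j => ?_) i j)
    (fun i j => hf j i) i j
  simp only [Matrix.add_apply]
  exact (measurable_matrix_mul (fun i j => hf j i) hf i j).add measurable_const

end Pinv

/-! ### Laplacians of graphs with equal components -/

theorem pinv_transpose_of_symm {n : Type*} [Fintype n] [DecidableEq n] {A : Matrix n n ℝ}
    (hA : A.transpose = A) : (pinv A).transpose = pinv A := by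
  have h := isMoorePenrose_pinv A
  refine IsMoorePenrose.unique (A := A) ⟨?_, ?_, ?_, ?_⟩ h
  · have := congrArg Matrix.transpose h.left
    simpa only [Matrix.transpose_mul, hA, Matrix.mul_assoc] using this
  · have := congrArg Matrix.transpose h.right
    simpa only [Matrix.transpose_mul, hA, Matrix.mul_assoc] using this
  · have := congrArg Matrix.transpose h.symm_right
    simpa only [Matrix.transpose_mul, hA, Matrix.transpose_transpose] using this
  · have := congrArg Matrix.transpose h.symm_left
    simpa only [Matrix.transpose_mul, hA, Matrix.transpose_transpose] using this

/-- For symmetric `A` the pseudo-inverse commutes with `A`, so `A†= A A† A†` has `A` as a left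
factor. -/
theorem mul_pinv_eq_zero {n : Type*} [Fintype n] [DecidableEq n] {A R : Matrix n n ℝ}
    (hA : A.transpose = A) (hR : R * A = 0) : R * pinv A = 0 := by
  have h := isMoorePenrose_pinv A
  have e : pinv A * A = A * pinv A := by
    rw [← h.symm_right, Matrix.transpose_mul, hA, pinv_transpose_of_symm hA]
  rw [← h.right, e, ← Matrix.mul_assoc, ← Matrix.mul_assoc, hR, Matrix.zero_mul, Matrix.zero_mul]

section Laplacian

variable {N : ℕ}

theorem entry_comm (a : Pair N → ℝ) (m n : Fin N) : entry a m n = entry a n m := by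
  rcases lt_trichotomy m n with h | h | h
  · simp [entry, h, h.not_gt]
  · rw [h]
  · simp [entry, h, h.not_gt]

theorem entry_self (a : Pair N → ℝ) (m : Fin N) : entry a m m = 0 := by
  simp [entry]

theorem entry_mem {a : Pair N → ℝ} {S : Set ℝ} (h0 : (0 : ℝ) ∈ S) (h : ∀ e, a e ∈ S)
    (m n : Fin N) : entry a m n ∈ S := by
  unfold entry
  split_ifs
  exacts [h _, h _, h0]

theorem laplacian_transpose (w : Pair N → ℝ) : (laplacian w).transpose = laplacian w := by
  ext m n
  by_cases h : m = n
  · rw [h, Matrix.transpose_apply]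
  · simp [laplacian, h, Ne.symm h, entry_comm w m n]

theorem laplacian_mulVec (w : Pair N → ℝ) (x : Fin N → ℝ) (m : Fin N) :
    (laplacian w).mulVec x m = ∑ k, entry w m k * (x m - x k) := by
  have e : ∀ k, laplacian w m k * x k
      = (if m = k then (∑ l, entry w m l) * x m else 0) - entry w m k * x k := by
    intro k
    by_cases h : m = k
    · subst h; simp [laplacian, entry_self]
    · simp [laplacian, h]
  simp only [Matrix.mulVec, dotProduct, e, Finset.sum_sub_distrib, Finset.sum_ite_eq,
    Finset.mem_univ, if_true, mul_sub, Finset.sum_mul]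

/-- Dirichlet form of the graph, obtained by symmetrizing the double sum. The `2` appears because
each edge is counted in both orders. -/
theorem dotProduct_laplacian_mulVec (w : Pair N → ℝ) (x : Fin N → ℝ) :
    2 * (x ⬝ᵥ (laplacian w).mulVec x) = ∑ m, ∑ k, entry w m k * (x m - x k) ^ 2 := by
  have e1 : x ⬝ᵥ (laplacian w).mulVec x = ∑ m, ∑ k, entry w m k * (x m * (x m - x k)) := by
    simp only [dotProduct, laplacian_mulVec, Finset.mul_sum]
    exact Finset.sum_congr rfl fun m _ => Finset.sum_congr rfl fun k _ => by ring
  have e2 : x ⬝ᵥ (laplacian w).mulVec x = ∑ m, ∑ k, entry w m k * (x k * (x k - x m)) := by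
    rw [e1, Finset.sum_comm]
    exact Finset.sum_congr rfl fun m _ => Finset.sum_congr rfl fun k _ => by rw [entry_comm]
  rw [two_mul]
  nth_rewrite 1 [e1]
  rw [e2]
  simp only [← Finset.sum_add_distrib]
  exact Finset.sum_congr rfl fun m _ => Finset.sum_congr rfl fun k _ => by ring

open Classical in
/-- The averaging over connected components of size `p`. -/
noncomputable def componentAverage (p : ℕ) (w : Pair N → ℝ) : Matrix (Fin N) (Fin N) ℝ :=
  Matrix.of fun m n => if (weightGraph w).Reachable m n then 1 / (p : ℝ) else 0

theorem componentAverage_congr (p : ℕ) {w : Pair N → ℝ} {m n m' n' : Fin N}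
    (h : (weightGraph w).Reachable m n ↔ (weightGraph w).Reachable m' n') :
    componentAverage p w m n = componentAverage p w m' n' :=
  by classical exact if_congr h rfl rfl

theorem componentAverage_transpose (p : ℕ) (w : Pair N → ℝ) :
    (componentAverage p w).transpose = componentAverage p w := by
  ext m n
  exact componentAverage_congr p SimpleGraph.reachable_comm

/-- Columns of the component average are constant along edges, hence in the kernel of the Laplacian.
Transposing gives the other order. -/
theorem componentAverage_mul_laplacian (p : ℕ) (w : Pair N → ℝ) :
    componentAverage p w * laplacian w = 0 := by
  have h : laplacian w * componentAverage p w = 0 := by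
    ext m n
    change (laplacian w).mulVec (fun k => componentAverage p w k n) m = 0
    rw [laplacian_mulVec]
    refine Finset.sum_eq_zero fun k _ => ?_
    by_cases hmk : m = k
    · rw [hmk, entry_self, zero_mul]
    by_cases h0 : entry w m k = 0
    · rw [h0, zero_mul]
    have hadj : (weightGraph w).Adj m k := ⟨hmk, h0⟩
    have : (weightGraph w).Reachable m n ↔ (weightGraph w).Reachable k n :=
      ⟨hadj.reachable.symm.trans, hadj.reachable.trans⟩
    rw [componentAverage_congr p this, sub_self, mul_zero]
  have := congrArg Matrix.transpose h
  simpa [Matrix.transpose_mul, laplacian_transpose, componentAverage_transpose] using this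

theorem sum_pinv_laplacian (w : Pair N → ℝ) (n : Fin N) :
    ∑ m, pinv (laplacian w) m n = 0 := by
  have h : (Matrix.of fun _ _ => 1 : Matrix (Fin N) (Fin N) ℝ) * laplacian w = 0 := by
    rw [← laplacian_transpose, ← Matrix.transpose_transpose (Matrix.of fun _ _ => (1 : ℝ)),
      ← Matrix.transpose_mul]
    ext m k
    change (laplacian w).mulVec (fun _ => 1) k = 0
    simp [laplacian_mulVec]
  have h2 := congrFun (congrFun (mul_pinv_eq_zero (laplacian_transpose w) h) n) n
  simpa [Matrix.mul_apply] using h2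

open Classical in
theorem StochasticSmacof.EqualComponents.card_reachable {p : ℕ} {w : Pair N → ℝ} (h : EqualComponents p w)
    (m : Fin N) : (Finset.univ.filter fun n => (weightGraph w).Reachable m n).card = p := by
  rw [← h ((weightGraph w).connectedComponentMk m), ← Set.ncard_coe_finset]
  congr 1
  ext n
  simp [SimpleGraph.reachable_comm]

theorem StochasticSmacof.EqualComponents.pos [NeZero N] {p : ℕ} {w : Pair N → ℝ} (h : EqualComponents p w) :
    0 < p := by
  classical
  rw [← h.card_reachable 0]
  exact Finset.card_pos.2 ⟨0, by simp⟩

theorem StochasticSmacof.EqualComponents.sum_componentAverage {p : ℕ} {w : Pair N → ℝ} (h : EqualComponents p w)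
    (m : Fin N) : ∑ n, componentAverage p w m n = 1 := by
  classical
  have : NeZero N := ⟨fun h => by subst h; exact m.elim0⟩
  have hp : (p : ℝ) ≠ 0 := by exact_mod_cast h.pos.ne'
  simp only [componentAverage, Matrix.of_apply]
  rw [← Finset.sum_filter, Finset.sum_const, h.card_reachable, nsmul_eq_mul, mul_one_div_cancel hp]

/-- The deviation from the component mean is a convex combination of differences within the
component. -/
theorem StochasticSmacof.EqualComponents.componentAverage_mulVec_sub {p : ℕ} {w : Pair N → ℝ}
    (h : EqualComponents p w) (x : Fin N → ℝ) {c : ℝ} {m : Fin N}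
    (hx : ∀ n, (weightGraph w).Reachable m n → |x m - x n| ≤ c) :
    |x m - (componentAverage p w).mulVec x m| ≤ c := by
  classical
  have e : x m - (componentAverage p w).mulVec x m
      = ∑ n, componentAverage p w m n * (x m - x n) := by
    simp only [mul_sub, Finset.sum_sub_distrib, ← Finset.sum_mul, h.sum_componentAverage m, one_mul]
    rfl
  rw [e]
  calc _ ≤ ∑ n, |componentAverage p w m n * (x m - x n)| := Finset.abs_sum_le_sum_abs _ _
    _ ≤ ∑ n, componentAverage p w m n * c := Finset.sum_le_sum fun n _ => by
      by_cases hr : (weightGraph w).Reachable m n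
      · have h0 : 0 ≤ componentAverage p w m n := by
          simp only [componentAverage, Matrix.of_apply, hr, if_true]; positivity
        rw [abs_mul, abs_of_nonneg h0]
        exact mul_le_mul_of_nonneg_left (hx n hr) h0
      · simp [componentAverage, hr]
    _ = c := by rw [← Finset.sum_mul, h.sum_componentAverage, one_mul]

variable {εw : ℝ} {w : Pair N → ℝ}

theorem entry_weight_nonneg (hεw : 0 < εw) (hw : ∀ e, w e ∈ {0} ∪ Set.Icc εw 1) (m n : Fin N) :
    0 ≤ entry w m n := by
  rcases entry_mem (by simp) hw m n with h | h
  · exact (Set.mem_singleton_iff.1 h).ge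
  · exact hεw.le.trans h.1

theorem sq_sub_le_of_adj (hεw : 0 < εw) (hw : ∀ e, w e ∈ {0} ∪ Set.Icc εw 1) (x : Fin N → ℝ)
    {m n : Fin N} (h : (weightGraph w).Adj m n) :
    (x m - x n) ^ 2 ≤ 2 / εw * (x ⬝ᵥ (laplacian w).mulVec x) := by
  have h1 : εw ≤ entry w m n := by
    rcases entry_mem (by simp) hw m n with h' | h'
    · exact absurd h' h.2
    · exact h'.1
  have hnn : ∀ m k, 0 ≤ entry w m k * (x m - x k) ^ 2 := fun m k =>
    mul_nonneg (entry_weight_nonneg hεw hw m k) (sq_nonneg _)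
  have h2 : entry w m n * (x m - x n) ^ 2 ≤ 2 * (x ⬝ᵥ (laplacian w).mulVec x) := by
    rw [dotProduct_laplacian_mulVec]
    exact (Finset.single_le_sum (f := fun k => entry w m k * (x m - x k) ^ 2)
      (fun k _ => hnn m k) (Finset.mem_univ n)).trans
      (Finset.single_le_sum (f := fun m => ∑ k, entry w m k * (x m - x k) ^ 2)
        (fun m _ => Finset.sum_nonneg fun k _ => hnn m k) (Finset.mem_univ m))
  rw [div_mul_eq_mul_div, le_div_iff₀ hεw]
  nlinarith [mul_le_mul_of_nonneg_right h1 (sq_nonneg (x m - x n))]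

/-- A discrete Poincaré inequality: add up the edge bounds along a path, which has fewer than `N`
edges. -/
theorem abs_sub_le_of_reachable (hεw : 0 < εw) (hw : ∀ e, w e ∈ {0} ∪ Set.Icc εw 1)
    (x : Fin N → ℝ) {m n : Fin N} (h : (weightGraph w).Reachable m n) :
    |x m - x n| ≤ N * Real.sqrt (2 / εw * (x ⬝ᵥ (laplacian w).mulVec x)) := by
  have key : ∀ {m n} (q : (weightGraph w).Walk m n),
      |x m - x n| ≤ q.length * Real.sqrt (2 / εw * (x ⬝ᵥ (laplacian w).mulVec x)) := by
    intro m n q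
    induction q with
    | nil => simp
    | @cons a b c hadj q ih =>
      have h1 := Real.abs_le_sqrt (sq_sub_le_of_adj hεw hw x hadj)
      have h2 := abs_sub_le (x a) (x b) (x c)
      rw [SimpleGraph.Walk.length_cons]
      push_cast
      linarith
  obtain ⟨q, hq⟩ := h.exists_isPath
  refine (key q).trans ?_
  have := hq.length_lt
  rw [Fintype.card_fin] at this
  gcongr

/-- A column `x` of `L†` has mean zero on each component, and by `L† L L† = L†` its energy is its
own diagonal entry `x n`. The Poincaré inequality thus gives `x k ^ 2 ≤ K * x n`. Taking `k = n`
yields `x n ≤ K`, and then all entries are bounded by `K`. -/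
theorem abs_pinv_laplacian_le {p : ℕ} (hcomp : EqualComponents p w) (hεw : 0 < εw)
    (hw : ∀ e, w e ∈ {0} ∪ Set.Icc εw 1) (m n : Fin N) :
    |pinv (laplacian w) m n| ≤ 2 * N ^ 2 / εw := by
  set L := laplacian w
  set G := pinv L with hG
  have hMP := isMoorePenrose_pinv L
  set x : Fin N → ℝ := fun k => G k n with hx
  have hPx : (componentAverage p w).mulVec x = 0 := by
    funext k
    exact congrFun (congrFun (mul_pinv_eq_zero (laplacian_transpose w)
      (componentAverage_mul_laplacian p w)) k) n
  have hq : x ⬝ᵥ L.mulVec x = x n := by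
    have h1 : G.transpose * (L * G) = G := by
      rw [pinv_transpose_of_symm (laplacian_transpose w), ← Matrix.mul_assoc, hMP.right]
    exact congrFun (congrFun h1 n) n
  have hb : ∀ k, x k ^ 2 ≤ 2 * N ^ 2 / εw * x n := by
    intro k
    have h1 := hcomp.componentAverage_mulVec_sub x (m := k)
      (fun l hl => abs_sub_le_of_reachable hεw hw x hl)
    rw [hPx, Pi.zero_apply, sub_zero] at h1
    have h0 : 0 ≤ 2 / εw * (x ⬝ᵥ L.mulVec x) := by
      have := dotProduct_laplacian_mulVec w x
      have h3 : 0 ≤ ∑ m, ∑ k, entry w m k * (x m - x k) ^ 2 :=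
        Finset.sum_nonneg fun m _ => Finset.sum_nonneg fun k _ =>
          mul_nonneg (entry_weight_nonneg hεw hw m k) (sq_nonneg _)
      have h4 : 0 ≤ x ⬝ᵥ L.mulVec x := by linarith
      positivity
    have h2 := pow_le_pow_left₀ (abs_nonneg _) h1 2
    rw [sq_abs, mul_pow, Real.sq_sqrt h0, hq] at h2
    calc _ ≤ _ := h2
      _ = _ := by ring
  set K := 2 * (N : ℝ) ^ 2 / εw with hK
  have hK0 : 0 ≤ K := by positivity
  have hn : x n ≤ K := by
    by_contra hlt
    push Not at hlt
    nlinarith [hb n]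
  exact abs_le_of_sq_le_sq (by nlinarith [hb m]) hK0

/-- Columns of `1 - L† L` have zero energy, so they are constant on components and fixed by the
component average. That average kills `L†`, hence maps `1 - L† L` to itself and also to the average.
-/
theorem pinv_mul_laplacian {p : ℕ} (hcomp : EqualComponents p w) (hεw : 0 < εw)
    (hw : ∀ e, w e ∈ {0} ∪ Set.Icc εw 1) :
    pinv (laplacian w) * laplacian w = 1 - componentAverage p w := by
  set L := laplacian w
  set Q := pinv L * L with hQ
  have h1 : L * (1 - Q) = 0 := by
    rw [Matrix.mul_sub, Matrix.mul_one, hQ, ← Matrix.mul_assoc, (isMoorePenrose_pinv L).left,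
      sub_self]
  have h2 : componentAverage p w * (1 - Q) = 1 - Q := by
    ext m n
    set x : Fin N → ℝ := fun k => (1 - Q) k n with hx
    have hLx : L.mulVec x = 0 := by
      funext k
      exact congrFun (congrFun h1 k) n
    have := hcomp.componentAverage_mulVec_sub x (m := m)
      (fun l hl => abs_sub_le_of_reachable hεw hw x hl)
    rw [show laplacian w = L from rfl, hLx, dotProduct_zero, mul_zero, Real.sqrt_zero,
      mul_zero] at this
    exact (sub_eq_zero.1 (abs_nonpos_iff.1 this)).symm
  have h3 : componentAverage p w * Q = 0 := by
    rw [hQ, ← Matrix.mul_assoc, mul_pinv_eq_zero (laplacian_transpose w)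
      (componentAverage_mul_laplacian p w), Matrix.zero_mul]
  rw [Matrix.mul_sub, Matrix.mul_one, h3, sub_zero] at h2
  rw [h2, sub_sub_cancel]

end Laplacian

/-! ### The drift of the stochastic iteration -/

theorem abs_sqrt_sq_add_sub_le {a b ε : ℝ} (ha : 0 ≤ a) (hb : 0 ≤ b) (hε : 0 < ε) :
    |Real.sqrt (a ^ 2 + ε) - Real.sqrt (b ^ 2 + ε)| ≤ |a - b| := by
  set s := Real.sqrt (a ^ 2 + ε)
  set r := Real.sqrt (b ^ 2 + ε)
  have hs : s ^ 2 = a ^ 2 + ε := Real.sq_sqrt (by positivity)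
  have hr : r ^ 2 = b ^ 2 + ε := Real.sq_sqrt (by positivity)
  have hs0 : 0 < s := Real.sqrt_pos.2 (by positivity)
  have hr0 : 0 < r := Real.sqrt_pos.2 (by positivity)
  have hsa : a ≤ s := Real.le_sqrt_of_sq_le (by linarith)
  have hrb : b ≤ r := Real.le_sqrt_of_sq_le (by linarith)
  have e : |s - r| * (s + r) = |a - b| * (a + b) := by
    rw [← abs_of_pos (show 0 < s + r by positivity), ← abs_mul,
      ← abs_of_nonneg (show 0 ≤ a + b by positivity), ← abs_mul]
    congr 1
    nlinarith
  have h : |a - b| * (a + b) ≤ |a - b| * (s + r) := by gcongr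
  exact le_of_mul_le_mul_right (e.trans_le h) (by positivity)

/-- The smoothed normalization `z ↦ z / √(‖z‖² + ε)` is Lipschitz. -/
theorem norm_smoothed_normalize_sub_le {E : Type*} [NormedAddCommGroup E] [NormedSpace ℝ E]
    {ε : ℝ} (hε : 0 < ε) (x y : E) :
    ‖(Real.sqrt (‖x‖ ^ 2 + ε))⁻¹ • x - (Real.sqrt (‖y‖ ^ 2 + ε))⁻¹ • y‖
      ≤ 2 / Real.sqrt ε * ‖x - y‖ := by
  have hd := abs_sqrt_sq_add_sub_le (norm_nonneg x) (norm_nonneg y) hε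
  have hsε : Real.sqrt ε ≤ Real.sqrt (‖x‖ ^ 2 + ε) := Real.sqrt_le_sqrt (by linarith [sq_nonneg ‖x‖])
  have hε0 : 0 < Real.sqrt ε := Real.sqrt_pos.2 hε
  have hry : ‖y‖ ≤ Real.sqrt (‖y‖ ^ 2 + ε) := Real.le_sqrt_of_sq_le (by linarith)
  have hr0 : 0 < Real.sqrt (‖y‖ ^ 2 + ε) := Real.sqrt_pos.2 (by positivity)
  set s := Real.sqrt (‖x‖ ^ 2 + ε)
  set r := Real.sqrt (‖y‖ ^ 2 + ε)
  have hs0 : 0 < s := hε0.trans_le hsε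
  -- Both terms are at most `‖x - y‖ / √ε`: in the second, `r⁻¹ * ‖y‖ ≤ 1` absorbs the size of `y`.
  have e : s⁻¹ • x - r⁻¹ • y = s⁻¹ • (x - y) + (s⁻¹ * ((r - s) * r⁻¹)) • y := by
    have : s⁻¹ * ((r - s) * r⁻¹) = s⁻¹ - r⁻¹ := by field_simp
    rw [this, smul_sub, sub_smul]
    abel
  have h1 : ‖(s⁻¹ * ((r - s) * r⁻¹)) • y‖ ≤ s⁻¹ * ‖x - y‖ := by
    rw [norm_smul, norm_mul, norm_mul, norm_inv, norm_inv, Real.norm_of_nonneg hs0.le,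
      Real.norm_of_nonneg hr0.le, mul_assoc, mul_assoc]
    refine mul_le_mul_of_nonneg_left ?_ (by positivity)
    have h2 : r⁻¹ * ‖y‖ ≤ 1 := by
      rw [inv_mul_le_iff₀ hr0]; linarith
    have h3 : ‖r - s‖ ≤ ‖x - y‖ := by
      rw [Real.norm_eq_abs, abs_sub_comm]
      exact hd.trans (abs_norm_sub_norm_le x y)
    calc ‖r - s‖ * (r⁻¹ * ‖y‖) ≤ ‖x - y‖ * 1 := by gcongr
      _ = _ := mul_one _
  rw [e]
  refine (norm_add_le _ _).trans ?_
  have h4 : ‖s⁻¹ • (x - y)‖ = s⁻¹ * ‖x - y‖ := by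
    rw [norm_smul, norm_inv, Real.norm_of_nonneg hs0.le]
  have h5 : s⁻¹ * ‖x - y‖ ≤ (Real.sqrt ε)⁻¹ * ‖x - y‖ := by gcongr
  rw [h4, div_eq_mul_inv]
  linarith

section Drift

variable {N P : ℕ}

/-- The difference of two rows as a Euclidean vector. -/
def rowDiff (m n : Fin N) (X : Matrix (Fin N) (Fin P) ℝ) : EuclideanSpace ℝ (Fin P) :=
  WithLp.toLp 2 fun k => X m k - X n k

theorem norm_rowDiff_sq (m n : Fin N) (X : Matrix (Fin N) (Fin P) ℝ) :
    ‖rowDiff m n X‖ ^ 2 = sqDist X m n := by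
  simp [EuclideanSpace.norm_sq_eq, rowDiff, sqDist]

theorem norm_toLp_row_le (X : Matrix (Fin N) (Fin P) ℝ) (m : Fin N) :
    ‖(WithLp.toLp 2 (X m) : EuclideanSpace ℝ (Fin P))‖ ≤ ‖X‖ := by
  rw [EuclideanSpace.norm_eq, Matrix.frobenius_norm_def, ← Real.sqrt_eq_rpow]
  apply Real.sqrt_le_sqrt
  simp only [Real.rpow_two]
  exact Finset.single_le_sum (f := fun i => ∑ j, ‖X i j‖ ^ 2)
    (fun i _ => Finset.sum_nonneg fun j _ => by positivity) (Finset.mem_univ m)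

theorem norm_rowDiff_sub_le (m n : Fin N) (X Y : Matrix (Fin N) (Fin P) ℝ) :
    ‖rowDiff m n X - rowDiff m n Y‖ ≤ 2 * ‖X - Y‖ := by
  have e : rowDiff m n X - rowDiff m n Y
      = WithLp.toLp 2 ((X - Y) m) - WithLp.toLp 2 ((X - Y) n) := by
    ext k
    simp [rowDiff]
    ring
  rw [e]
  refine (norm_sub_le _ _).trans ?_
  linarith [norm_toLp_row_le (X - Y) m, norm_toLp_row_le (X - Y) n]

/-- Exhibits `B(X) X` through smoothed normalizations of row differences, which makes it globally
Lipschitz in `X`. -/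
theorem bMatrix_mul_apply (εx : ℝ) (w δ : Pair N → ℝ) (X : Matrix (Fin N) (Fin P) ℝ)
    (m : Fin N) (k : Fin P) : (bMatrix εx w δ X * X) m k = ∑ n, entry w m n * entry δ m n *
      ((Real.sqrt (‖rowDiff m n X‖ ^ 2 + εx))⁻¹ • rowDiff m n X) k := by
  have e : ∀ n, bMatrix εx w δ X m n * X n k
      = (if m = n then (∑ l, entry w m l * entry δ m l / Real.sqrt (sqDist X m l + εx)) * X m k
        else 0) - entry w m n * entry δ m n / Real.sqrt (sqDist X m n + εx) * X n k := by
    intro n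
    by_cases h : m = n
    · subst h; simp [bMatrix, entry_self]
    · simp [bMatrix, h]
  simp only [Matrix.mul_apply, e, Finset.sum_sub_distrib, Finset.sum_ite_eq, Finset.mem_univ,
    if_true, Finset.sum_mul]
  rw [← Finset.sum_sub_distrib]
  refine Finset.sum_congr rfl fun n _ => ?_
  rw [norm_rowDiff_sq, PiLp.smul_apply, smul_eq_mul]
  simp only [rowDiff]
  ring

variable {εx εw Cδ : ℝ} {w δ : Pair N → ℝ}

theorem abs_entry_mul_entry_le (hεw : 0 < εw) (hw : ∀ e, w e ∈ {0} ∪ Set.Icc εw 1)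
    (hδ : ∀ e, δ e ∈ Set.Ioc 0 Cδ) (m n : Fin N) : |entry w m n * entry δ m n| ≤ |Cδ| := by
  have hw1 : |entry w m n| ≤ 1 := by
    rcases entry_mem (by simp) hw m n with h | h
    · rw [Set.mem_singleton_iff.1 h]; simp
    · rw [abs_of_nonneg (hεw.le.trans h.1)]; exact h.2
  have hδ1 : |entry δ m n| ≤ |Cδ| := by
    rw [abs_le]
    exact entry_mem (S := Set.Icc (-|Cδ|) |Cδ|) (by simp) (fun e => ⟨(neg_nonpos.2 (abs_nonneg _)).trans (hδ e).1.le,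
      (hδ e).2.trans (le_abs_self _)⟩) m n
  rw [abs_mul]
  calc _ ≤ 1 * |Cδ| := by gcongr
    _ = _ := one_mul _

theorem norm_bMatrix_mul_sub_le (hεx : 0 < εx) (hεw : 0 < εw)
    (hw : ∀ e, w e ∈ {0} ∪ Set.Icc εw 1) (hδ : ∀ e, δ e ∈ Set.Ioc 0 Cδ)
    (X Y : Matrix (Fin N) (Fin P) ℝ) :
    ‖bMatrix εx w δ X * X - bMatrix εx w δ Y * Y‖
      ≤ Real.sqrt (N * P) * (N * (|Cδ| * (2 / Real.sqrt εx * (2 * ‖X - Y‖)))) := by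
  have h := Matrix.frobenius_le_of_abs_apply_le
    (A := bMatrix εx w δ X * X - bMatrix εx w δ Y * Y)
    (c := N * (|Cδ| * (2 / Real.sqrt εx * (2 * ‖X - Y‖)))) (by positivity) (fun m k => ?_)
  · simpa only [Fintype.card_fin] using h
  rw [Matrix.sub_apply, bMatrix_mul_apply, bMatrix_mul_apply, ← Finset.sum_sub_distrib]
  refine (Finset.abs_sum_le_sum_abs _ _).trans ?_
  calc _ ≤ ∑ _n : Fin N, |Cδ| * (2 / Real.sqrt εx * (2 * ‖X - Y‖)) :=
        Finset.sum_le_sum fun n _ => ?_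
    _ = _ := by simp
  rw [← mul_sub, abs_mul]
  have h1 := abs_entry_mul_entry_le hεw hw hδ m n
  have h2 := (PiLp.norm_apply_le ((Real.sqrt (‖rowDiff m n X‖ ^ 2 + εx))⁻¹ • rowDiff m n X
    - (Real.sqrt (‖rowDiff m n Y‖ ^ 2 + εx))⁻¹ • rowDiff m n Y) k).trans
    (norm_smoothed_normalize_sub_le hεx (rowDiff m n X) (rowDiff m n Y))
  have h3 := norm_rowDiff_sub_le m n X Y
  refine mul_le_mul h1 (h2.trans ?_) (abs_nonneg _) (abs_nonneg _)
  gcongr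

/-- The increment per unit step size of the stochastic SMACOF iteration. -/
noncomputable def drift (εx : ℝ) (w δ : Pair N → ℝ) (X : Matrix (Fin N) (Fin P) ℝ) :
    Matrix (Fin N) (Fin P) ℝ :=
  pinv (laplacian w) * (bMatrix εx w δ X * X) - pinv (laplacian w) * laplacian w * X

theorem drift_zero (εx : ℝ) (w δ : Pair N → ℝ) :
    drift εx w δ (0 : Matrix (Fin N) (Fin P) ℝ) = 0 := by
  simp [drift]

theorem stochIter_eq_stepIter (εx μ : ℝ) (w δ : ℕ → Pair N → ℝ) (X₀ : Matrix (Fin N) (Fin P) ℝ)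
    (t : ℕ) : stochIter εx μ w δ X₀ t = stepIter μ (fun s => drift εx (w s) (δ s)) X₀ t := by
  induction t with
  | zero => rfl
  | succ t ih =>
    rw [stochIter, stepIter, ih, drift]
    simp only [Matrix.sub_mul, Matrix.one_mul, Matrix.smul_mul, smul_sub, Matrix.mul_assoc]
    abel

/-- The constant combines entrywise bounds on `L†` and `L` with the Lipschitz bound for `B(X) X`. It
is chosen before `w` and `δ`, hence is deterministic. -/
theorem exists_drift_lipschitz (N P p : ℕ) {εx εw : ℝ} (Cδ : ℝ) (hεx : 0 < εx) (hεw : 0 < εw) :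
    ∃ Λ : ℝ, 0 ≤ Λ ∧ ∀ w δ : Pair N → ℝ, EqualComponents p w →
      (∀ e, w e ∈ {0} ∪ Set.Icc εw 1) → (∀ e, δ e ∈ Set.Ioc 0 Cδ) →
      ∀ X Y : Matrix (Fin N) (Fin P) ℝ, ‖drift εx w δ X - drift εx w δ Y‖ ≤ Λ * ‖X - Y‖ := by
  set KG := Real.sqrt (N * N) * (2 * (N : ℝ) ^ 2 / εw)
  set KL := Real.sqrt (N * N) * (N : ℝ)
  set KB := Real.sqrt (N * P) * (N * (|Cδ| * (2 / Real.sqrt εx * 2)))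
  refine ⟨KG * KB + KG * KL, by positivity, fun w δ hc hw hδ X Y => ?_⟩
  have hG : ‖pinv (laplacian w)‖ ≤ KG := by
    simpa only [Fintype.card_fin] using Matrix.frobenius_le_of_abs_apply_le (by positivity)
      (abs_pinv_laplacian_le hc hεw hw)
  have hL : ‖laplacian w‖ ≤ KL := by
    have hw1 : ∀ m n, |entry w m n| ≤ 1 := by
      intro m n
      rw [abs_of_nonneg (entry_weight_nonneg hεw hw m n)]
      rcases entry_mem (by simp) hw m n with h | h
      · rw [Set.mem_singleton_iff.1 h]; exact zero_le_one
      · exact h.2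
    have h := Matrix.frobenius_le_of_abs_apply_le (A := laplacian w) (c := (N : ℝ)) (by positivity)
      (fun m n => ?_)
    · simpa only [Fintype.card_fin] using h
    by_cases h : m = n
    · simp only [laplacian, Matrix.of_apply, h, if_true]
      refine (Finset.abs_sum_le_sum_abs _ _).trans ?_
      exact (Finset.sum_le_sum fun k _ => hw1 n k).trans (by simp)
    · simp only [laplacian, Matrix.of_apply, h, if_false, abs_neg]
      have : (1 : ℝ) ≤ N := by exact_mod_cast Nat.succ_le_of_lt (Nat.zero_lt_of_lt m.2)
      exact (hw1 m n).trans this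
  have hB := norm_bMatrix_mul_sub_le hεx hεw hw hδ X Y
  have e : drift εx w δ X - drift εx w δ Y
      = pinv (laplacian w) * (bMatrix εx w δ X * X - bMatrix εx w δ Y * Y)
        - pinv (laplacian w) * (laplacian w * (X - Y)) := by
    simp only [drift, Matrix.mul_sub, Matrix.mul_assoc]
    abel
  have h1 : ‖pinv (laplacian w) * (bMatrix εx w δ X * X - bMatrix εx w δ Y * Y)‖
      ≤ KG * (KB * ‖X - Y‖) := by
    refine (Matrix.frobenius_norm_mul _ _).trans ?_
    have : KB * ‖X - Y‖
        = Real.sqrt (N * P) * (N * (|Cδ| * (2 / Real.sqrt εx * (2 * ‖X - Y‖)))) := by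
      simp only [KB]; ring
    rw [this]
    gcongr
  have h2 : ‖pinv (laplacian w) * (laplacian w * (X - Y))‖ ≤ KG * (KL * ‖X - Y‖) := by
    refine (Matrix.frobenius_norm_mul _ _).trans ?_
    have := Matrix.frobenius_norm_mul (laplacian w) (X - Y)
    gcongr
    exact this.trans (by gcongr)
  rw [e]
  refine (norm_sub_le _ _).trans ?_
  linarith

end Drift

/-! ### Measurability of the drift and of both iterations -/

section Measurability

variable {N P : ℕ} {α : Type*} [MeasurableSpace α]

theorem measurable_entry {a : α → Pair N → ℝ} (ha : Measurable a) (m n : Fin N) :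
    Measurable fun x => entry (a x) m n := by
  unfold entry
  split_ifs
  exacts [(measurable_pi_apply _).comp ha, (measurable_pi_apply _).comp ha, measurable_const]

theorem measurable_laplacian {w : α → Pair N → ℝ} (hw : Measurable w) (m n : Fin N) :
    Measurable fun x => laplacian (w x) m n := by
  by_cases h : m = n
  · simp only [laplacian, Matrix.of_apply, h, if_true]
    exact Finset.measurable_sum _ fun k _ => measurable_entry hw _ _
  · simp only [laplacian, Matrix.of_apply, h, if_false]
    exact (measurable_entry hw _ _).neg

theorem measurable_bMatrix (εx : ℝ) {w δ : α → Pair N → ℝ} (hw : Measurable w)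
    (hδ : Measurable δ) {X : α → Matrix (Fin N) (Fin P) ℝ}
    (hX : ∀ i j, Measurable fun x => X x i j) (m n : Fin N) :
    Measurable fun x => bMatrix εx (w x) (δ x) (X x) m n := by
  have key : ∀ m n, Measurable fun x =>
      entry (w x) m n * entry (δ x) m n / Real.sqrt (sqDist (X x) m n + εx) := by
    intro m n
    refine ((measurable_entry hw _ _).mul (measurable_entry hδ _ _)).div
      (Measurable.sqrt (Measurable.add_const ?_ _))
    unfold sqDist
    exact Finset.measurable_sum _ fun k _ => ((hX _ _).sub (hX _ _)).pow_const 2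
  by_cases h : m = n
  · simp only [bMatrix, Matrix.of_apply, h, if_true]
    exact Finset.measurable_sum _ fun k _ => key _ _
  · simp only [bMatrix, Matrix.of_apply, h, if_false]
    exact (key _ _).neg

theorem measurable_drift (εx : ℝ) {w δ : α → Pair N → ℝ} (hw : Measurable w)
    (hδ : Measurable δ) {X : α → Matrix (Fin N) (Fin P) ℝ}
    (hX : ∀ i j, Measurable fun x => X x i j) (m : Fin N) (k : Fin P) :
    Measurable fun x => drift εx (w x) (δ x) (X x) m k := by
  have hG := measurable_pinv (measurable_laplacian hw)
  exact (measurable_matrix_mul hG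
      (fun i j => measurable_matrix_mul (measurable_bMatrix εx hw hδ hX) hX i j) m k).sub
    (measurable_matrix_mul (fun i j => measurable_matrix_mul hG (measurable_laplacian hw) i j)
      hX m k)

theorem measurable_stochIter (εx μ : ℝ) {w δ : ℕ → α → Pair N → ℝ} (hw : ∀ t, Measurable (w t))
    (hδ : ∀ t, Measurable (δ t)) {X₀ : α → Matrix (Fin N) (Fin P) ℝ}
    (hX : ∀ i j, Measurable fun x => X₀ x i j) (t : ℕ) (m : Fin N) (k : Fin P) :
    Measurable fun x => stochIter εx μ (fun s => w s x) (fun s => δ s x) (X₀ x) t m k := by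
  simp only [stochIter_eq_stepIter]
  induction t generalizing m k with
  | zero => exact hX m k
  | succ t ih => exact (ih m k).add ((measurable_drift εx (hw t) (hδ t) ih m k).const_mul μ)

/-- A parameter integral: the integrand is jointly measurable in the parameter and the sample point.
-/
theorem measurable_avgB {Ω : Type*} [MeasurableSpace Ω] (Pr : Measure Ω) [SFinite Pr] (εx : ℝ)
    {w δ : Ω → Pair N → ℝ} (hw : Measurable w) (hδ : Measurable δ)
    {X : α → Matrix (Fin N) (Fin P) ℝ} (hX : ∀ i j, Measurable fun x => X x i j) (m n : Fin N) :
    Measurable fun x => avgB Pr εx w δ (X x) m n := by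
  have hw' : Measurable fun z : α × Ω => w z.2 := hw.comp measurable_snd
  have hδ' : Measurable fun z : α × Ω => δ z.2 := hδ.comp measurable_snd
  have hX' : ∀ i j, Measurable fun z : α × Ω => X z.1 i j := fun i j => (hX i j).comp measurable_fst
  have h := measurable_matrix_mul (measurable_pinv (measurable_laplacian hw'))
    (measurable_bMatrix εx hw' hδ' hX') m n
  exact (h.stronglyMeasurable.integral_prod_right' (ν := Pr)).measurable

theorem measurable_avgIter {Ω : Type*} [MeasurableSpace Ω] (Pr : Measure Ω) [SFinite Pr]
    (p : ℕ) (εx μ : ℝ) {w δ : Ω → Pair N → ℝ} (hw : Measurable w) (hδ : Measurable δ)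
    {X₀ : α → Matrix (Fin N) (Fin P) ℝ} (hX : ∀ i j, Measurable fun x => X₀ x i j)
    (t : ℕ) (m : Fin N) (k : Fin P) :
    Measurable fun x => avgIter p μ (avgB Pr εx w δ) (X₀ x) t m k := by
  induction t generalizing m k with
  | zero => exact hX m k
  | succ t ih =>
    exact ((ih m k).const_mul _).add
      ((measurable_matrix_mul (measurable_avgB Pr εx hw hδ ih) ih m k).const_mul μ)

end Measurability

/-! ### The mean drift -/

section MeanDrift

variable {Ω : Type*} [MeasurableSpace Ω] {Pr : Measure Ω} {N P p : ℕ}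
  {εx εw Cδ : ℝ} {w δ : Ω → Pair N → ℝ}

/-- The expected drift. -/
noncomputable def meanDrift (Pr : Measure Ω) (εx : ℝ) (w δ : Ω → Pair N → ℝ)
    (X : Matrix (Fin N) (Fin P) ℝ) : Matrix (Fin N) (Fin P) ℝ :=
  Matrix.of fun m k => ∫ ω, drift εx (w ω) (δ ω) X m k ∂Pr

/-- Both terms of the drift have `L†` as leftmost factor, whose columns sum to zero. This is what
keeps the mean-drift path centered. -/
theorem sum_drift (εx : ℝ) (w δ : Pair N → ℝ) (X : Matrix (Fin N) (Fin P) ℝ) (k : Fin P) :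
    ∑ m, drift εx w δ X m k = 0 := by
  have key : ∀ Y : Matrix (Fin N) (Fin P) ℝ, ∑ m, (pinv (laplacian w) * Y) m k = 0 := by
    intro Y
    simp only [Matrix.mul_apply]
    rw [Finset.sum_comm]
    simp only [← Finset.sum_mul, sum_pinv_laplacian, zero_mul, Finset.sum_const_zero]
  simp only [drift, Matrix.sub_apply, Finset.sum_sub_distrib, Matrix.mul_assoc, key, sub_zero]

theorem integrable_drift [IsProbabilityMeasure Pr] (hw : Measurable w) (hδ : Measurable δ) {Λ : ℝ}
    (hΛ : ∀ᵐ ω ∂Pr, ∀ X Y : Matrix (Fin N) (Fin P) ℝ,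
      ‖drift εx (w ω) (δ ω) X - drift εx (w ω) (δ ω) Y‖ ≤ Λ * ‖X - Y‖)
    (X : Matrix (Fin N) (Fin P) ℝ) (m : Fin N) (k : Fin P) :
    Integrable (fun ω => drift εx (w ω) (δ ω) X m k) Pr := by
  refine Integrable.of_bound (measurable_drift εx hw hδ (X := fun _ => X)
    (fun _ _ => measurable_const) m k).aestronglyMeasurable (Λ * ‖X‖) ?_
  filter_upwards [hΛ] with ω h
  have := h X 0
  rw [drift_zero, sub_zero, sub_zero] at this
  exact (Matrix.abs_apply_le_frobenius _ m k).trans this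

theorem norm_meanDrift_sub_le [IsProbabilityMeasure Pr] (hw : Measurable w) (hδ : Measurable δ) {Λ : ℝ} (hΛ0 : 0 ≤ Λ)
    (hΛ : ∀ᵐ ω ∂Pr, ∀ X Y : Matrix (Fin N) (Fin P) ℝ,
      ‖drift εx (w ω) (δ ω) X - drift εx (w ω) (δ ω) Y‖ ≤ Λ * ‖X - Y‖)
    (X Y : Matrix (Fin N) (Fin P) ℝ) :
    ‖meanDrift Pr εx w δ X - meanDrift Pr εx w δ Y‖ ≤ Real.sqrt (N * P) * Λ * ‖X - Y‖ := by
  have h := Matrix.frobenius_le_of_abs_apply_le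
    (A := meanDrift Pr εx w δ X - meanDrift Pr εx w δ Y) (c := Λ * ‖X - Y‖) (by positivity)
    (fun m k => ?_)
  · simpa only [Fintype.card_fin, mul_assoc] using h
  simp only [meanDrift, Matrix.sub_apply, Matrix.of_apply]
  rw [← integral_sub (integrable_drift hw hδ hΛ X m k) (integrable_drift hw hδ hΛ Y m k)]
  have := norm_integral_le_of_norm_le_const (μ := Pr) (C := Λ * ‖X - Y‖)
    (f := fun ω => drift εx (w ω) (δ ω) X m k - drift εx (w ω) (δ ω) Y m k) (by
      filter_upwards [hΛ] with ω h
      exact (Matrix.abs_apply_le_frobenius (drift εx (w ω) (δ ω) X - drift εx (w ω) (δ ω) Y)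
        m k).trans (h X Y))
  simpa using this

theorem meanDrift_zero :
    meanDrift Pr εx w δ (0 : Matrix (Fin N) (Fin P) ℝ) = 0 := by
  ext m k
  simp [meanDrift, drift_zero]

theorem sum_meanDrift [IsProbabilityMeasure Pr] (hw : Measurable w) (hδ : Measurable δ) {Λ : ℝ}
    (hΛ : ∀ᵐ ω ∂Pr, ∀ X Y : Matrix (Fin N) (Fin P) ℝ,
      ‖drift εx (w ω) (δ ω) X - drift εx (w ω) (δ ω) Y‖ ≤ Λ * ‖X - Y‖)
    (X : Matrix (Fin N) (Fin P) ℝ) (k : Fin P) : ∑ m, meanDrift Pr εx w δ X m k = 0 := by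
  simp only [meanDrift, Matrix.of_apply]
  rw [← integral_finsetSum _ fun m _ => integrable_drift hw hδ hΛ X m k]
  simp only [sum_drift, integral_zero]

theorem abs_bMatrix_le (hεx : 0 < εx) (hεw : 0 < εw) {w δ : Pair N → ℝ}
    (hw : ∀ e, w e ∈ {0} ∪ Set.Icc εw 1) (hδ : ∀ e, δ e ∈ Set.Ioc 0 Cδ)
    (X : Matrix (Fin N) (Fin P) ℝ) (m n : Fin N) :
    |bMatrix εx w δ X m n| ≤ N * (|Cδ| / Real.sqrt εx) := by
  have hε0 : 0 < Real.sqrt εx := Real.sqrt_pos.2 hεx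
  have key : ∀ m n, |entry w m n * entry δ m n / Real.sqrt (sqDist X m n + εx)|
      ≤ |Cδ| / Real.sqrt εx := by
    intro m n
    have h1 := abs_entry_mul_entry_le hεw hw hδ m n
    have h2 : Real.sqrt εx ≤ Real.sqrt (sqDist X m n + εx) := Real.sqrt_le_sqrt (by
      have : 0 ≤ sqDist X m n := Finset.sum_nonneg fun k _ => sq_nonneg _
      linarith)
    rw [abs_div, abs_of_nonneg (Real.sqrt_nonneg _)]
    gcongr
  by_cases h : m = n
  · simp only [bMatrix, Matrix.of_apply, h, if_true]
    exact (Finset.abs_sum_le_sum_abs _ _).trans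
      ((Finset.sum_le_sum fun k _ => key n k).trans (by simp))
  · simp only [bMatrix, Matrix.of_apply, h, if_false, abs_neg]
    have : (1 : ℝ) ≤ N := by exact_mod_cast Nat.succ_le_of_lt (Nat.zero_lt_of_lt m.2)
    exact (key m n).trans (le_mul_of_one_le_left (by positivity) this)

theorem integrable_pinv_mul_bMatrix [IsProbabilityMeasure Pr] (hεx : 0 < εx) (hεw : 0 < εw) (hw : Measurable w)
    (hδ : Measurable δ) (hcomp : ∀ᵐ ω ∂Pr, EqualComponents p (w ω))
    (hwb : ∀ᵐ ω ∂Pr, ∀ e, w ω e ∈ {0} ∪ Set.Icc εw 1) (hδb : ∀ᵐ ω ∂Pr, ∀ e, δ ω e ∈ Set.Ioc 0 Cδ)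
    (X : Matrix (Fin N) (Fin P) ℝ) (m n : Fin N) :
    Integrable (fun ω => (pinv (laplacian (w ω)) * bMatrix εx (w ω) (δ ω) X) m n) Pr := by
  refine Integrable.of_bound (measurable_matrix_mul (measurable_pinv (measurable_laplacian hw))
    (measurable_bMatrix εx hw hδ (X := fun _ => X) fun _ _ => measurable_const) m n).aestronglyMeasurable
    (∑ _l : Fin N, 2 * N ^ 2 / εw * (N * (|Cδ| / Real.sqrt εx))) ?_
  filter_upwards [hcomp, hwb, hδb] with ω h1 h2 h3
  rw [Matrix.mul_apply]
  refine norm_sum_le_of_le _ fun l _ => ?_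
  rw [norm_mul]
  exact mul_le_mul (abs_pinv_laplacian_le h1 hεw h2 m l) (abs_bMatrix_le hεx hεw h2 h3 X l n)
    (abs_nonneg _) (by positivity)

theorem componentAverage_mem_Icc (p : ℕ) (w : Pair N → ℝ) (m n : Fin N) :
    componentAverage p w m n ∈ Set.Icc (0 : ℝ) 1 := by
  simp only [componentAverage, Matrix.of_apply]
  split_ifs
  · exact ⟨by positivity, by
      rcases Nat.eq_zero_or_pos p with rfl | hp
      · simp
      · rw [div_le_one (by positivity)]; exact_mod_cast hp⟩
  · simp

/-- Almost surely this is an entry of `1 - L† L`, so measurability comes from that of `L†` rather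
than from the graph. -/
theorem aemeasurable_componentAverage (hεw : 0 < εw) (hw : Measurable w)
    (hcomp : ∀ᵐ ω ∂Pr, EqualComponents p (w ω))
    (hwb : ∀ᵐ ω ∂Pr, ∀ e, w ω e ∈ {0} ∪ Set.Icc εw 1) (m n : Fin N) :
    AEMeasurable (fun ω => componentAverage p (w ω) m n) Pr := by
  refine ⟨fun ω => (1 : Matrix (Fin N) (Fin N) ℝ) m n
    - (pinv (laplacian (w ω)) * laplacian (w ω)) m n,
    (measurable_matrix_mul (measurable_pinv (measurable_laplacian hw)) (measurable_laplacian hw)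
      m n).const_sub _, ?_⟩
  filter_upwards [hcomp, hwb] with ω h1 h2
  rw [pinv_mul_laplacian h1 hεw h2, Matrix.sub_apply, sub_sub_cancel]

theorem integrable_componentAverage [IsProbabilityMeasure Pr] (hεw : 0 < εw) (hw : Measurable w)
    (hcomp : ∀ᵐ ω ∂Pr, EqualComponents p (w ω))
    (hwb : ∀ᵐ ω ∂Pr, ∀ e, w ω e ∈ {0} ∪ Set.Icc εw 1) (m n : Fin N) :
    Integrable (fun ω => componentAverage p (w ω) m n) Pr := by
  refine Integrable.of_bound
    (aemeasurable_componentAverage hεw hw hcomp hwb m n).aestronglyMeasurable 1 ?_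
  refine Eventually.of_forall fun ω => ?_
  have h := componentAverage_mem_Icc p (w ω) m n
  rw [Real.norm_of_nonneg h.1]
  exact h.2

/-- The expected component average acts on each entry off the diagonal in the same way. -/
theorem integral_componentAverage [IsProbabilityMeasure Pr] (hN : 2 ≤ N) (hεw : 0 < εw) (hw : Measurable w)
    (hcomp : ∀ᵐ ω ∂Pr, EqualComponents p (w ω))
    (hwb : ∀ᵐ ω ∂Pr, ∀ e, w ω e ∈ {0} ∪ Set.Icc εw 1)
    (hpairs : ∀ m n m' n' : Fin N, m ≠ n → m' ≠ n' →
      Pr {ω | (weightGraph (w ω)).Reachable m n} = Pr {ω | (weightGraph (w ω)).Reachable m' n'})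
    (m n : Fin N) :
    ∫ ω, componentAverage p (w ω) m n ∂Pr
      = if m = n then 1 / (p : ℝ) else ((p : ℝ) - 1) / (p * (N - 1)) := by
  classical
  have hNZ : NeZero N := ⟨by omega⟩
  obtain ⟨ω₀, hω₀⟩ := hcomp.exists
  have hp : (p : ℝ) ≠ 0 := by exact_mod_cast hω₀.pos.ne'
  have hN1 : (N : ℝ) - 1 ≠ 0 := by
    have : (2 : ℝ) ≤ N := by exact_mod_cast hN
    intro h; linarith
  have hform : ∀ m n, ∫ ω, componentAverage p (w ω) m n ∂Pr
      = Pr.real {ω | (weightGraph (w ω)).Reachable m n} * (1 / (p : ℝ)) := by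
    intro m n
    have hset : {ω | (weightGraph (w ω)).Reachable m n}
        = (fun ω => componentAverage p (w ω) m n) ⁻¹' {0}ᶜ := by
      ext ω
      by_cases h : (weightGraph (w ω)).Reachable m n <;> simp [componentAverage, h]
      exact_mod_cast hp
    have hnull : NullMeasurableSet {ω | (weightGraph (w ω)).Reachable m n} Pr := by
      rw [hset]
      exact (aemeasurable_componentAverage hεw hw hcomp hwb m n).nullMeasurable
        (measurableSet_singleton 0).compl
    have e : (fun ω => componentAverage p (w ω) m n)
        = {ω | (weightGraph (w ω)).Reachable m n}.indicator fun _ => 1 / (p : ℝ) := by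
      funext ω
      by_cases h : (weightGraph (w ω)).Reachable m n <;> simp [componentAverage, h]
    rw [e, integral_indicator₀ hnull, setIntegral_const, smul_eq_mul]
  have hdiag : ∀ m, ∫ ω, componentAverage p (w ω) m m ∂Pr = 1 / (p : ℝ) := by
    intro m
    rw [hform]
    simp
  by_cases hmn : m = n
  · subst hmn; simp only [if_true]; exact hdiag m
  rw [if_neg hmn]
  set q := ∫ ω, componentAverage p (w ω) m n ∂Pr with hq
  have hoff : ∀ k, k ≠ m → ∫ ω, componentAverage p (w ω) m k ∂Pr = q := by
    intro k hk
    rw [hq, hform, hform, measureReal_def, measureReal_def, hpairs m k m n (Ne.symm hk) hmn]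
  -- Rows of the component average sum to one, so `1 / p + (N - 1) * q = 1`, which determines `q`.
  have hsum : ∑ k, ∫ ω, componentAverage p (w ω) m k ∂Pr = 1 := by
    rw [← integral_finsetSum _ fun k _ => integrable_componentAverage hεw hw hcomp hwb m k]
    rw [integral_congr_ae (g := fun _ => (1 : ℝ)) (by
      filter_upwards [hcomp] with ω h using h.sum_componentAverage m)]
    simp
  rw [← Finset.add_sum_erase _ _ (Finset.mem_univ m), hdiag,
    Finset.sum_congr rfl (fun k hk => hoff k (Finset.ne_of_mem_erase hk)), Finset.sum_const,
    Finset.card_erase_of_mem (Finset.mem_univ m), Finset.card_univ, Fintype.card_fin,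
    nsmul_eq_mul, Nat.cast_sub (by omega), Nat.cast_one] at hsum
  field_simp at hsum ⊢
  linarith

/-- The expected component average is a multiple of the identity plus a multiple of the all-ones
matrix, which kills centered `X`. What is left of `I - E[componentAverage]` is the scalar `1 - 1/p +
(p-1)/(p(N-1)) = υ`. -/
theorem meanDrift_eq [IsProbabilityMeasure Pr] (hN : 2 ≤ N) (hεx : 0 < εx) (hεw : 0 < εw) (hw : Measurable w)
    (hδ : Measurable δ) (hcomp : ∀ᵐ ω ∂Pr, EqualComponents p (w ω))
    (hwb : ∀ᵐ ω ∂Pr, ∀ e, w ω e ∈ {0} ∪ Set.Icc εw 1) (hδb : ∀ᵐ ω ∂Pr, ∀ e, δ ω e ∈ Set.Ioc 0 Cδ)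
    (hpairs : ∀ m n m' n' : Fin N, m ≠ n → m' ≠ n' →
      Pr {ω | (weightGraph (w ω)).Reachable m n} = Pr {ω | (weightGraph (w ω)).Reachable m' n'})
    {X : Matrix (Fin N) (Fin P) ℝ} (hX : ∀ k, ∑ m, X m k = 0) :
    meanDrift Pr εx w δ X = avgB Pr εx w δ X * X - upsilon N p • X := by
  have hNZ : NeZero N := ⟨by omega⟩
  obtain ⟨ω₀, hω₀⟩ := hcomp.exists
  have hp : (p : ℝ) ≠ 0 := by exact_mod_cast hω₀.pos.ne'
  have hN1 : (N : ℝ) - 1 ≠ 0 := by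
    have : (2 : ℝ) ≤ N := by exact_mod_cast hN
    intro h; linarith
  ext m k
  have hB := integrable_pinv_mul_bMatrix (Pr := Pr) hεx hεw hw hδ hcomp hwb hδb X
  have hC := integrable_componentAverage (Pr := Pr) hεw hw hcomp hwb
  have e : ∀ᵐ ω ∂Pr, drift εx (w ω) (δ ω) X m k
      = ∑ n, (pinv (laplacian (w ω)) * bMatrix εx (w ω) (δ ω) X) m n * X n k
        - (X m k - ∑ n, componentAverage p (w ω) m n * X n k) := by
    filter_upwards [hcomp, hwb] with ω h1 h2
    rw [drift, pinv_mul_laplacian h1 hεw h2, ← Matrix.mul_assoc, Matrix.sub_mul, Matrix.one_mul,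
      Matrix.sub_apply, Matrix.sub_apply, Matrix.mul_apply (M := _ * _),
      Matrix.mul_apply (M := componentAverage p (w ω))]
  have i1 : Integrable (fun ω =>
      ∑ n, (pinv (laplacian (w ω)) * bMatrix εx (w ω) (δ ω) X) m n * X n k) Pr :=
    integrable_finsetSum _ fun n _ => (hB m n).mul_const _
  have i2 : Integrable (fun ω => ∑ n, componentAverage p (w ω) m n * X n k) Pr :=
    integrable_finsetSum _ fun n _ => (hC m n).mul_const _
  have i3 : Integrable (fun ω => X m k - ∑ n, componentAverage p (w ω) m n * X n k) Pr :=
    (integrable_const (X m k)).sub i2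
  have s1 : ∫ ω, ∑ n, (pinv (laplacian (w ω)) * bMatrix εx (w ω) (δ ω) X) m n * X n k ∂Pr
      = (avgB Pr εx w δ X * X) m k := by
    rw [integral_finsetSum _ fun n _ => (hB m n).mul_const _, Matrix.mul_apply]
    exact Finset.sum_congr rfl fun n _ => integral_mul_const _ _
  have s2 : ∫ ω, ∑ n, componentAverage p (w ω) m n * X n k ∂Pr
      = (1 / (p : ℝ) - ((p : ℝ) - 1) / (p * (N - 1))) * X m k := by
    rw [integral_finsetSum _ fun n _ => (hC m n).mul_const _]
    have : ∀ n, ∫ ω, componentAverage p (w ω) m n * X n k ∂Pr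
        = (if m = n then (1 / (p : ℝ) - ((p : ℝ) - 1) / (p * (N - 1))) * X m k else 0)
          + ((p : ℝ) - 1) / (p * (N - 1)) * X n k := by
      intro n
      rw [integral_mul_const, integral_componentAverage hN hεw hw hcomp hwb hpairs]
      split_ifs with h
      · subst h; ring
      · ring
    simp only [this, Finset.sum_add_distrib, ← Finset.mul_sum, hX, Finset.sum_ite_eq,
      Finset.mem_univ, if_true, mul_zero, add_zero]
  simp only [meanDrift, Matrix.of_apply]
  rw [integral_congr_ae e, integral_sub i1 i3, integral_sub (integrable_const _) i2, s1, s2, integral_const, Matrix.sub_apply,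
    Matrix.smul_apply]
  simp only [probReal_univ, smul_eq_mul, upsilon]
  field_simp
  ring

end MeanDrift

/-! ### Law of large numbers for the drift and the comparison of the iterations -/

/-- At a fixed `X` each entry of the drift is one measurable function of the i.i.d. data, so the
strong law applies entry by entry. -/
theorem ae_tendsto_cesaro_drift {Ω : Type*} [MeasurableSpace Ω] {Pr : Measure Ω}
    [IsProbabilityMeasure Pr] {N P : ℕ} {εx : ℝ} {w δ : ℕ → Ω → Pair N → ℝ}
    (hiid : IIDData Pr w δ) {Λ : ℝ}
    (hΛ : ∀ᵐ ω ∂Pr, ∀ X Y : Matrix (Fin N) (Fin P) ℝ,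
      ‖drift εx (w 0 ω) (δ 0 ω) X - drift εx (w 0 ω) (δ 0 ω) Y‖ ≤ Λ * ‖X - Y‖)
    (X : Matrix (Fin N) (Fin P) ℝ) :
    ∀ᵐ ω ∂Pr, ∀ m k, Tendsto
      (fun T : ℕ => (T : ℝ)⁻¹ • ∑ s ∈ Finset.range T, drift εx (w s ω) (δ s ω) X m k) atTop
      (𝓝 (meanDrift Pr εx (w 0) (δ 0) X m k)) := by
  rw [ae_all_iff]; intro m
  rw [ae_all_iff]; intro k
  have hg : Measurable fun z : (Pair N → ℝ) × (Pair N → ℝ) => drift εx z.1 z.2 X m k :=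
    measurable_drift εx measurable_fst measurable_snd (X := fun _ => X)
      (fun _ _ => measurable_const) m k
  exact strong_law_ae (fun t ω => drift εx (w t ω) (δ t ω) X m k)
    (integrable_drift (hiid.measurable_weight 0) (hiid.measurable_dissim 0) hΛ X m k)
    (fun i j hij => (hiid.indep.indepFun hij).comp hg hg)
    (fun t => (hiid.identDistrib t).comp hg)

theorem exists_denseRange_seq {E : Type*} [NormedAddCommGroup E] [ProperSpace E] :
    ∃ d : ℕ → E, DenseRange d :=
  ⟨_, TopologicalSpace.denseRange_denseSeq E⟩

/-- The two fields are only known to agree on centered matrices, so centeredness is carried along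
the path. -/
theorem avgIter_eq_stepIter {N P p : ℕ} {μ : ℝ}
    {Ba : Matrix (Fin N) (Fin P) ℝ → Matrix (Fin N) (Fin N) ℝ}
    {h : Matrix (Fin N) (Fin P) ℝ → Matrix (Fin N) (Fin P) ℝ}
    (hsum : ∀ X k, ∑ m, h X m k = 0)
    (hh : ∀ X : Matrix (Fin N) (Fin P) ℝ, (∀ k, ∑ m, X m k = 0) →
      h X = Ba X * X - upsilon N p • X)
    {X₀ : Matrix (Fin N) (Fin P) ℝ} (hX₀ : ∀ k, ∑ m, X₀ m k = 0) (t : ℕ) :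
    avgIter p μ Ba X₀ t = stepIter μ (fun _ => h) X₀ t := by
  have hc : ∀ t k, ∑ m, stepIter μ (fun _ => h) X₀ t m k = 0 := by
    intro t
    induction t with
    | zero => exact hX₀
    | succ t ih =>
      intro k
      simp only [stepIter, Matrix.add_apply, Matrix.smul_apply, smul_eq_mul,
        Finset.sum_add_distrib, ← Finset.mul_sum, ih, hsum, mul_zero, add_zero]
  induction t with
  | zero => rfl
  | succ t ih =>
    rw [avgIter, stepIter, ih, hh _ (hc t), sub_smul, one_smul, smul_sub, smul_smul]
    abel

theorem ae_eventually_norm_iter_sub_le {Ω : Type*} [MeasurableSpace Ω] {Pr : Measure Ω}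
    [IsProbabilityMeasure Pr] {N P p : ℕ} (hN : 2 ≤ N) {εx εw Cδ : ℝ} (hεx : 0 < εx)
    (hεw : 0 < εw) {w δ : ℕ → Ω → Pair N → ℝ} {X₀ : Ω → Matrix (Fin N) (Fin P) ℝ}
    (hX₀ : ∀ ω k, ∑ m, X₀ ω m k = 0) (hcomp : ∀ t, ∀ᵐ ω ∂Pr, EqualComponents p (w t ω))
    (hiid : IIDData Pr w δ) (hbdd : BoundedData Pr Cδ εw w δ)
    (hpairs : ∀ m n m' n' : Fin N, m ≠ n → m' ≠ n' →
      Pr {ω | (weightGraph (w 0 ω)).Reachable m n}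
        = Pr {ω | (weightGraph (w 0 ω)).Reachable m' n'}) :
    ∀ᵐ ω ∂Pr, ∀ ε > 0, ∀ᶠ μ in 𝓝[>] (0 : ℝ), ∀ t : ℕ, (t : ℝ) ≤ 1 / μ →
      ‖stochIter εx μ (fun s => w s ω) (fun s => δ s ω) (X₀ ω) t
        - avgIter p μ (avgB Pr εx (w 0) (δ 0)) (X₀ ω) t‖ ≤ ε := by
  obtain ⟨Λ, hΛ0, hΛ⟩ := exists_drift_lipschitz N P p (εx := εx) (εw := εw) Cδ hεx hεw
  have hwb : ∀ t, ∀ᵐ ω ∂Pr, ∀ e, w t ω e ∈ {0} ∪ Set.Icc εw 1 := fun t =>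
    ae_all_iff.2 (hbdd.weight_mem t)
  have hδb : ∀ t, ∀ᵐ ω ∂Pr, ∀ e, δ t ω e ∈ Set.Ioc 0 Cδ := fun t =>
    ae_all_iff.2 (hbdd.dissim_mem t)
  have hLip : ∀ t, ∀ᵐ ω ∂Pr, ∀ X Y : Matrix (Fin N) (Fin P) ℝ,
      ‖drift εx (w t ω) (δ t ω) X - drift εx (w t ω) (δ t ω) Y‖ ≤ Λ * ‖X - Y‖ := by
    intro t
    filter_upwards [hcomp t, hwb t, hδb t] with ω h1 h2 h3 using hΛ _ _ h1 h2 h3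
  have hw0 := hiid.measurable_weight 0
  have hδ0 := hiid.measurable_dissim 0
  have : ProperSpace (Matrix (Fin N) (Fin P) ℝ) := FiniteDimensional.proper_real _
  obtain ⟨d, hd⟩ := exists_denseRange_seq (E := Matrix (Fin N) (Fin P) ℝ)
  -- Countably many points give one null set, which depends on neither `ε` nor `μ`.
  have hlln := ae_all_iff.2 fun i => ae_tendsto_cesaro_drift hiid (hLip 0) (d i)
  filter_upwards [ae_all_iff.2 hLip, hlln] with ω hL hlim ε hε
  have hmain := eventually_norm_stepIter_sub_le (Λ := Λ + Real.sqrt (N * P) * Λ) (d := d)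
    (F := fun t => drift εx (w t ω) (δ t ω)) (h := meanDrift Pr εx (w 0) (δ 0))
    (by positivity)
    (fun t X Y => (hL t X Y).trans (by gcongr; exact le_add_of_nonneg_right (by positivity)))
    (fun t => drift_zero _ _ _)
    (fun X Y => (norm_meanDrift_sub_le hw0 hδ0 hΛ0 (hLip 0) X Y).trans
      (by gcongr; exact le_add_of_nonneg_left hΛ0))
    meanDrift_zero hd
    (fun i => by
      refine tendsto_pi_nhds.2 fun m => tendsto_pi_nhds.2 fun k => (hlim i m k).congr fun T => ?_
      rw [Matrix.smul_apply, Matrix.sum_apply])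
    (X₀ ω) hε
  filter_upwards [hmain] with μ hμ t ht
  rw [stochIter_eq_stepIter, avgIter_eq_stepIter (sum_meanDrift hw0 hδ0 (hLip 0))
    (fun X hX => meanDrift_eq hN hεx hεw hw0 hδ0 (hcomp 0) (hwb 0) (hδb 0) hpairs hX) (hX₀ ω)]
  exact hμ t ht

theorem proposition1
    {Ω : Type*} [MeasurableSpace Ω] (Pr : Measure Ω) [IsProbabilityMeasure Pr]
    (N P p : ℕ) (hN : 2 ≤ N)
    (εx εw Cδ Cx : ℝ) (hεx : 0 < εx) (hεw : 0 < εw)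
    (w δ : ℕ → Ω → Pair N → ℝ)
    (X₀ : Ω → Matrix (Fin N) (Fin P) ℝ)
    -- the common starting point: a random matrix, centered at the origin
    (hX₀_meas : ∀ m k, Measurable fun ω => X₀ ω m k)
    (hX₀_centered : ∀ ω k, ∑ m, X₀ ω m k = 0)
    -- all components of the graph have size `p`
    (hcomp : ∀ t, ∀ᵐ ω ∂Pr, EqualComponents p (w t ω))
    (hiid : IIDData Pr w δ)
    (hbdd : BoundedData Pr Cδ εw w δ)
    (hinit : ∀ ω, ‖centering N * X₀ ω‖ ≤ Cx)
    (hcontr : ContractingProducts Pr p w)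
    (hhom : ∀ t, HomogeneousWeights Pr (w t)) :
    ∃ c : ℝ → Ω → ℝ,
      (∀ μ ∈ Set.Ioo (0 : ℝ) 1, Measurable (c μ) ∧
        ∀ ω, ∀ t : ℕ, 1 ≤ t → (t : ℝ) ≤ 1 / μ →
          ‖stochIter εx μ (fun s => w s ω) (fun s => δ s ω) (X₀ ω) t
            - avgIter p μ (avgB Pr εx (w 0) (δ 0)) (X₀ ω) t‖ ≤ c μ ω) ∧
      ∀ᵐ ω ∂Pr, Tendsto (fun μ => c μ ω) (𝓝[>] 0) (𝓝 0) := by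
  -- The maximal distance itself. The index set is finite, so the supremum is bounded and
  -- measurable, and its `+ 1` includes the time `⌊1 / μ⌋₊`. The time `0` is harmless, since both
  -- iterations start at `X₀`.
  refine ⟨fun μ ω => ⨆ t : Fin (⌊1 / μ⌋₊ + 1),
    ‖stochIter εx μ (fun s => w s ω) (fun s => δ s ω) (X₀ ω) t
      - avgIter p μ (avgB Pr εx (w 0) (δ 0)) (X₀ ω) t‖, fun μ _ => ⟨?_, ?_⟩, ?_⟩
  · refine Measurable.iSup fun t => measurable_frobenius_norm fun m k => ?_
    exact (measurable_stochIter εx μ hiid.measurable_weight hiid.measurable_dissim hX₀_meas t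
      m k).sub (measurable_avgIter Pr p εx μ (hiid.measurable_weight 0) (hiid.measurable_dissim 0)
      hX₀_meas t m k)
  · intro ω t _ ht
    exact le_ciSup (f := fun t : Fin (⌊1 / μ⌋₊ + 1) =>
      ‖stochIter εx μ (fun s => w s ω) (fun s => δ s ω) (X₀ ω) t
        - avgIter p μ (avgB Pr εx (w 0) (δ 0)) (X₀ ω) t‖) (Set.finite_range _).bddAbove
      ⟨t, Nat.lt_succ_of_le (Nat.le_floor ht)⟩
  · filter_upwards [ae_eventually_norm_iter_sub_le hN hεx hεw hX₀_centered hcomp hiid hbdd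
      (hhom 0).equal_pairs] with ω hω
    rw [Metric.tendsto_nhds]
    intro ε hε
    filter_upwards [hω (ε / 2) (half_pos hε), self_mem_nhdsWithin] with μ hμ hμ0
    rw [Real.dist_eq, sub_zero, abs_of_nonneg (Real.iSup_nonneg fun _ => norm_nonneg _)]
    refine (ciSup_le fun t : Fin (⌊1 / μ⌋₊ + 1) => hμ t ?_).trans_lt (half_lt_self hε)
    have h0 : (0 : ℝ) ≤ 1 / μ := one_div_nonneg.2 (le_of_lt hμ0)
    exact (Nat.le_floor_iff h0).1 (Nat.le_of_lt_succ t.2)
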